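/- **Theorem 5 (Additive code formulation).** Let $q$ be a power of a prime $p$, let $F$ be a subfield of $\mathbb F_q$ (for instance $\mathbb F_q$ or $\mathbb F_p$), let $\mathrm{tr}$ be the trace from $\mathbb F_{q^2}$ to $F$, and put $(u,v)_t=\mathrm{tr}\big(\gamma\sum_j u_j v_j^q\big)$ on $\mathbb F_{q^2}^n$, where either $\gamma=1$ (the trace Hermitian form) or $0\ne\gamma\in\mathbb F_{q^2}$ with $\gamma^q=-\gamma$ (an alternating form; for even $q$ this includes $\gamma=1$). For an additive subgroup $\mathcal C\le\mathbb F_{q^2}^n$ let $\mathcal C^{\perp_t}=\{u:(u,v)_t=0\ \forall v\in\mathcal C\}$ and $R_t(\mathcal C)=\mathcal C\cap\mathcal C^{\perp_t}$; $\mathcal C$ is ACD if $R_t(\mathcal C)=0$ and trace self-orthogonal if $\mathcal C\subseteq\mathcal C^{\perp_t}$. Let $\mathcal C=R_t(\mathcal C)\oplus\mathcal C_e$ be an additive code in $\mathbb F_{q^2}^n$ with $\mathcal C_e$ ACD, $|R_t(\mathcal C)|=q^l$ and $|\mathcal C_e|=q^{2c}$. Let $\mathcal C^b\le\mathbb F_{q^2}^m$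 be a trace self-orthogonal additive code with $|\mathcal C^b|=q^r$ and $c\le k_b:=m-r$. Then $k:=n-c-l\ge 0$, and: 1. There is a combination EAQECC-Ne $[[n,k,d_{ea};c]]_q+[[m,k_b]]_q$. 2. Suppose that $\gamma^q=-\gamma$ and that $\mathcal C$ and $\mathcal C^b$ are closed under multiplication by $F$. Then for every $\beta\in\mathbb F_{q^2}$ such that $\{\beta,\beta^q\}$ is an $\mathbb F_q$-basis of $\mathbb F_{q^2}$ and $\gamma(\beta^2-\beta^{2q})\in F$, there is a combination EAQECC-Ne $[[n,k,d_{ea};c]]_q+[[m,k_b]]_q$ whose EA-stabilizer corresponds to $\mathcal C$ and whose stabilizer $\mathcal S^b$ corresponds to $\mathcal C^b$ under $X(\mathbf a)Z(\mathbf b)\mapsto\beta\mathbf a+\beta^q\mathbf b$ (phases ignored), and $d_{ea}=\min\{\mathrm{wt}(u):u\in\mathcal C^{\perp_t}\setminus R_t(\mathcal C)\}$. Here $X(\mathbf a)Z(\mathbf b)|\mathbf j\rangle=\omega^{\mathrm{tr}_{\mathbb F_q/\mathbb F_p}(\mathbf b\cdot\mathbf j)}|\mathbf j+\mathbf a\rangle$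 with $\omega=e^{2\pi i/p}$. A stabilizer group is an Abelian group of unitary scalar multiples of such operators whose only scalar element is the identity; it stabilizes the space of the states that all its elements fix. An EAQECC $[[n,k,d_{ea};c]]_q$ is a code $Q=\{(V\otimes 1)(\psi\otimes\Phi)\}$ on $n+c$ qudits, with $V$ an isometry of the sender from $k+c$ qudits to $n$ qudits and $\Phi$ the state of $c$ maximally entangled pairs; $d_{ea}$ is the least weight of a Pauli error on the sender's $n$ qudits that $Q$ does not detect in the Knill–Laflamme sense ($d_{ea}=\infty$ and $\min\emptyset=\infty$ if there is none, which is the case when $k=0$). A group $\mathcal S$ of Pauli operators modulo phases on $n$ qudits EA-stabilizes $Q$ if its elements extend, each in one way, to a stabilizer group on $n+c$ qudits that stabilizes $Q$. A combination EAQECC-Ne $[[n,k,d_{ea};c]]_q+[[m,k_b]]_q$ is given by such an $\mathcal S$, which EA-stabilizes an $[[n,k,d_{ea};c]]_q$, and a stabilizer group $\mathcal S^b$ on $m$ qudits that stabilizes a code of dimension $q^{k_b}$, where $k_b\ge c$. -/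

import Mathlib

open scoped Matrix

/-! ### Additive codes over `L = F_{q²}`, where `K = F_q` -/

section AdditiveCodes

variable (F K : Type*) {L : Type*} [Field F] [Field K] [Fintype K] [Field L] [Algebra F L]
  {ι : Type*} [Fintype ι]

/-- The Hermitian inner product `∑ⱼ uⱼ vⱼ^q` on `L^ι`, with `q = |K|`. -/
def hermInner (u v : ι → L) : L := ∑ j, u j * v j ^ Fintype.card K

/-- The trace inner product `tr (γ · (u, v)_h)`, with `tr` the trace from `L` to `F`.
For `γ = 1` it is `tr (u, v)_h`; for `γ^q = -γ` it is an alternating form. -/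
noncomputable def traceInner (γ : L) (u v : ι → L) : F :=
  Algebra.trace F L (γ * hermInner K u v)

/-- The trace dual of an additive code. -/
def traceDual (γ : L) (C : AddSubgroup (ι → L)) : AddSubgroup (ι → L) where
  carrier := {u | ∀ v ∈ C, traceInner F K γ u v = 0}
  zero_mem' := by
    intro v _
    simp [traceInner, hermInner]
  add_mem' := by
    intro a b ha hb v hv
    have h1 := ha v hv
    have h2 := hb v hv
    simp only [traceInner, hermInner] at h1 h2 ⊢
    simp only [Pi.add_apply, add_mul, Finset.sum_add_distrib, mul_add, map_add, h1, h2, add_zero]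
  neg_mem' := by
    intro a ha v hv
    have h1 := ha v hv
    simp only [traceInner, hermInner] at h1 ⊢
    simp only [Pi.neg_apply, neg_mul, Finset.sum_neg_distrib, mul_neg, map_neg, h1, neg_zero]

/-- The trace radical `R_t(C) = C ∩ C^⊥t`. -/
def traceRadical (γ : L) (C : AddSubgroup (ι → L)) : AddSubgroup (ι → L) :=
  C ⊓ traceDual F K γ C

/-- Additive complementary dual codes. -/
def IsACD (γ : L) (C : AddSubgroup (ι → L)) : Prop := traceRadical F K γ C = ⊥

/-- Trace self-orthogonal codes. -/
def IsTraceSelfOrthogonal (γ : L) (C : AddSubgroup (ι → L)) : Prop := C ≤ traceDual F K γ C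

/-- The minimum Hamming weight of the words of `C^⊥t` outside `R_t(C)` (`⊤` if there are none). -/
noncomputable def codeDistance [DecidableEq L] (γ : L) (C : AddSubgroup (ι → L)) : ℕ∞ :=
  ⨅ u ∈ {u : ι → L | u ∈ traceDual F K γ C ∧ u ∉ traceRadical F K γ C}, (hammingNorm u : ℕ∞)

end AdditiveCodes

/-- The space `F_q^{2n}` of pairs `(a|b)`; it indexes the Pauli operators up to phase. -/
abbrev PhaseSpace (K ι : Type*) : Type _ := (ι → K) × (ι → K)

/-- The map `φ (a|b) = β a + β^q b` from `F_q^{2n}` to `F_{q²}^n`. -/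
def phaseToCode {K L ι : Type*} [Field K] [Fintype K] [Field L] [Algebra K L] (β : L)
    (s : PhaseSpace K ι) : ι → L :=
  fun j => β * algebraMap K L (s.1 j) + β ^ Fintype.card K * algebraMap K L (s.2 j)

/-- The weight of `(a|b)`: the number of coordinates `j` with `(aⱼ, bⱼ) ≠ (0, 0)`. -/
def pauliWeight {K ι : Type*} [Field K] [DecidableEq K] [Fintype ι] (s : PhaseSpace K ι) : ℕ :=
  (Finset.univ.filter fun j => s.1 j ≠ 0 ∨ s.2 j ≠ 0).card

/-! ### Pauli operators and stabilizer codes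

The qudits are indexed by `ι`. The state space `(ℂ^q)^{⊗ι}` is `(ι → K) → ℂ`: the basis vector
`|j⟩`, with `j : ι → K`, is the indicator function of `j`. -/

section Pauli

variable (p : ℕ) [Fact p.Prime] {K : Type*} [Field K] [Fintype K] [DecidableEq K]
  [Algebra (ZMod p) K] {ι : Type*} [Fintype ι] [DecidableEq ι]

/-- The operator `X(a) Z(b)`, which maps `|j⟩` to `ω^{tr(b·j)} |j + a⟩`. Here `ω = e^{2πi/p}`,
`tr : F_q → F_p` is the trace, and `ZMod.stdAddChar` is `x ↦ ω^x`. -/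
noncomputable def pauli (s : PhaseSpace K ι) : Matrix (ι → K) (ι → K) ℂ :=
  fun i j => if i = j + s.1 then ZMod.stdAddChar (Algebra.trace (ZMod p) K (s.2 ⬝ᵥ j)) else 0

/-- The image under `τ : (phase) X(a) Z(b) ↦ (a|b)` of a group of operators. -/
def tauImage (S : Subgroup (Matrix.unitaryGroup (ι → K) ℂ)) : Set (PhaseSpace K ι) :=
  {s | ∃ g ∈ S, ∃ z : ℂ, (g : Matrix (ι → K) (ι → K) ℂ) = z • pauli p s}

/-- Stabilizer groups: Abelian groups of (phases times) Pauli operators that contain no scalar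
operator except the identity. The last condition forces the phases to be `p`-th roots of unity
for odd `p`, and fourth roots of unity for `p = 2`. -/
structure IsStabilizerGroup (S : Subgroup (Matrix.unitaryGroup (ι → K) ℂ)) : Prop where
  isPauli : ∀ g ∈ S, ∃ (z : ℂ) (s : PhaseSpace K ι),
    (g : Matrix (ι → K) (ι → K) ℂ) = z • pauli p s
  comm : ∀ g ∈ S, ∀ h ∈ S, g * h = h * g
  scalar : ∀ g ∈ S, ∀ z : ℂ,
    (g : Matrix (ι → K) (ι → K) ℂ) = z • (1 : Matrix (ι → K) (ι → K) ℂ) → z = 1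

/-- The quantum code stabilized by `S`: all states fixed by every element of `S`. -/
def codeSpace (S : Subgroup (Matrix.unitaryGroup (ι → K) ℂ)) : Submodule ℂ ((ι → K) → ℂ) where
  carrier := {v | ∀ g ∈ S, (g : Matrix (ι → K) (ι → K) ℂ) *ᵥ v = v}
  zero_mem' := by
    intro g _
    exact Matrix.mulVec_zero _
  add_mem' := by
    intro a b ha hb g hg
    rw [Matrix.mulVec_add, ha g hg, hb g hg]
  smul_mem' := by
    intro z a ha g hg
    rw [Matrix.mulVec_smul, ha g hg]

/-- The Knill–Laflamme condition: the code `Q` detects the error `E`, that is, `P E P = z P` for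
some scalar `z`, where `P` is the orthogonal projection onto `Q`. -/
def Detects (Q : Submodule ℂ ((ι → K) → ℂ)) (E : Matrix (ι → K) (ι → K) ℂ) : Prop :=
  ∃ z : ℂ, ∀ u ∈ Q, ∀ v ∈ Q, star u ⬝ᵥ (E *ᵥ v) = z * (star u ⬝ᵥ v)

end Pauli

/-! ### Entanglement-assisted codes

The sender holds `n` qudits, the receiver holds `c` qudits: one half of each of `c` maximally
entangled pairs. The joint system is indexed by `Fin n ⊕ Fin c`. -/

section EA

variable (p : ℕ) [Fact p.Prime] {K : Type*} [Field K] [Fintype K] [DecidableEq K]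
  [Algebra (ZMod p) K] {n c : ℕ}

/-- The part of a Pauli operator on the sender's qudits. -/
def senderPart (s : PhaseSpace K (Fin n ⊕ Fin c)) : PhaseSpace K (Fin n) :=
  (s.1 ∘ Sum.inl, s.2 ∘ Sum.inl)

/-- A Pauli operator of the sender, seen on the joint system. -/
def onSender (c : ℕ) (s : PhaseSpace K (Fin n)) : PhaseSpace K (Fin n ⊕ Fin c) :=
  (Sum.elim s.1 0, Sum.elim s.2 0)

/-- `Q` is the set of the encoded states of an entanglement-assisted code with `k` logical
qudits: for some isometry `V` of the sender, from `k` logical qudits and her halves of the `c`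
pairs into her `n` qudits, `Q` consists of the states `(V ⊗ 1) (ψ ⊗ Φ)`, where `ψ` is a state of
the `k` logical qudits and `Φ = q^{-c/2} ∑_y |y⟩|y⟩`. -/
def IsEACode (k : ℕ) (Q : Submodule ℂ ((Fin n ⊕ Fin c → K) → ℂ)) : Prop :=
  ∃ V : Matrix (Fin n → K) ((Fin k → K) × (Fin c → K)) ℂ, Vᴴ * V = 1 ∧
    ∀ w : (Fin n ⊕ Fin c → K) → ℂ, w ∈ Q ↔
      ∃ ψ : (Fin k → K) → ℂ, ∀ (x : Fin n → K) (y : Fin c → K),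
        w (Sum.elim x y) =
          ((Real.sqrt ((Fintype.card K : ℝ) ^ c))⁻¹ : ℝ) * ∑ s, V x (s, y) * ψ s

/-- The distance of an entanglement-assisted code: the least weight of an error on the sender's
qudits which is not detected (`⊤` if every such error is detected, as happens for `k = 0`). -/
noncomputable def eaDistance (Q : Submodule ℂ ((Fin n ⊕ Fin c → K) → ℂ)) : ℕ∞ :=
  ⨅ e ∈ {e : PhaseSpace K (Fin n) | ¬ Detects Q (pauli p (onSender c e))}, (pauliWeight e : ℕ∞)

/-- `S`, a subgroup of the projective Pauli group `F_q^{2n}` of the sender, is an EA-stabilizer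
of `Q`: the elements of `S` extend, each in one way, to the joint system so as to form an Abelian
stabilizer group whose stabilized code is `Q`. -/
def EAStabilizes (S : AddSubgroup (PhaseSpace K (Fin n)))
    (Q : Submodule ℂ ((Fin n ⊕ Fin c → K) → ℂ)) : Prop :=
  ∃ T : Subgroup (Matrix.unitaryGroup (Fin n ⊕ Fin c → K) ℂ),
    IsStabilizerGroup p T ∧ Set.BijOn senderPart (tauImage p T) (S : Set (PhaseSpace K (Fin n))) ∧
      codeSpace T = Q

/-- `S` EA-stabilizes an EAQECC `[[n, k, d; c]]_q`. -/
def EAStabilizesParams (S : AddSubgroup (PhaseSpace K (Fin n))) (k : ℕ) (d : ℕ∞) (c : ℕ) : Prop :=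
  ∃ Q : Submodule ℂ ((Fin n ⊕ Fin c → K) → ℂ),
    EAStabilizes p S Q ∧ IsEACode k Q ∧ eaDistance p Q = d

/-- `Sb` stabilizes an `[[m, kb]]_q` quantum code. -/
def StabilizesParams {m : ℕ} (Sb : Subgroup (Matrix.unitaryGroup (Fin m → K) ℂ)) (kb : ℕ) : Prop :=
  IsStabilizerGroup p Sb ∧ Module.finrank ℂ (codeSpace Sb) = Fintype.card K ^ kb

/-- The matching pair `(S, Sb)` describes a combination EAQECC-Ne
`[[n, k, d; c]]_q + [[m, kb]]_q`: the sender uses an EAQECC with EA-stabilizer `S`, and the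
receiver protects his `c` ebits by a code with stabilizer `Sb`, which has room for them. -/
structure IsCombination {m : ℕ} (S : AddSubgroup (PhaseSpace K (Fin n)))
    (Sb : Subgroup (Matrix.unitaryGroup (Fin m → K) ℂ)) (k : ℕ) (d : ℕ∞) (c kb : ℕ) : Prop where
  sender : EAStabilizesParams p S k d c
  receiver : StabilizesParams p Sb kb
  ebits_le : c ≤ kb

end EA

/-! Non-negativity of `k` is a count. The trace form is nondegenerate, so `|C| · |C^⊥t| ≤ q^(2n)`;
since `R_t(C) ⊆ C^⊥t`, this gives `(l + 2c) + l ≤ 2n`. Statement 1 only asks for the parameters, so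
subgroups generated by single-qudit `X`- and `Z`-type operators realize it.

For statement 2, the trace to `F_q` of `γ (u, v)_h`, pulled back along `(a|b) ↦ βa + β^q b`, is a
nonzero `a ∈ F` times the `F_q`-valued symplectic form. For `F`-linear codes the trace dual is
therefore the dual for the `F_p`-valued form that governs commutation of Pauli operators
(`phaseToCode_mem_traceDual_iff`). So `C` becomes a subgroup `S` of order `q^(l+2c)` with radical of
order `q^l`.

The core is `eaStabilizesParams_of_card`. Modulo its radical, `S` is a nondegenerate alternating
`F_p`-space of the size of the phase space of `c` qudits, and such spaces are classified by
dimension. Hence there is a surjection `f` from `S` to that phase space that reverses the sign of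
the form (`exists_antiisometry`). The graph of `f` is isotropic, and a common eigenvector of its
commuting Pauli operators lifts it to a stabilizer group (`exists_isStabilizerGroup`). Its code has
dimension `q^(n+c-(l+2c)) = q^k` by a trace computation. Because `f` is onto, every nontrivial Pauli
operator of the receiver maps the code into its orthogonal complement; this says that the receiver's
half is maximally entangled, which produces the encoding isometry (`isEACode_of_receiver`). Finally,
a sender error is undetected exactly when it is orthogonal to `S` but outside `S`. -/

set_option linter.unusedSectionVars false

/-! ### Isometries of alternating spaces -/

section Alternating

variable {k : Type*} [Field k]

theorem exists_hyperbolic_pair {V : Type*} [AddCommGroup V] [Module k V] [Nontrivial V]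
    {B : V →ₗ[k] V →ₗ[k] k} (hB : ∀ x, (∀ y, B x y = 0) → x = 0) :
    ∃ e f, B e f = 1 := by
  obtain ⟨e, he⟩ := exists_ne (0 : V)
  by_contra! h
  refine he (hB e fun y => ?_)
  by_contra hy
  exact h e ((B e y)⁻¹ • y) (by simp [hy])

/-- The orthogonal complement of the plane spanned by `e` and `f`. -/
def planeOrthogonal {V : Type*} [AddCommGroup V] [Module k V] (B : V →ₗ[k] V →ₗ[k] k)
    (e f : V) : Submodule k V :=
  LinearMap.ker ((B e).prod (B f))

/-! ### Splitting off a hyperbolic plane. -/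

section Plane

variable {V : Type*} [AddCommGroup V] [Module k V] {B : V →ₗ[k] V →ₗ[k] k} {e f : V}

theorem mem_planeOrthogonal {x : V} : x ∈ planeOrthogonal B e f ↔ B e x = 0 ∧ B f x = 0 := by
  simp [planeOrthogonal]

theorem isAlt_apply_swap (hA : B.IsAlt) (hef : B e f = 1) : B f e = -1 := by
  rw [← hA.neg, hef]

theorem planeOrthogonal_proj_mem (hA : B.IsAlt) (hef : B e f = 1) (x : V) :
    x + B f x • e - B e x • f ∈ planeOrthogonal B e f := by
  have := isAlt_apply_swap hA hef
  rw [mem_planeOrthogonal]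
  constructor <;> simp [hA.self_eq_zero, hef, this]

/-- The orthogonal projection onto `planeOrthogonal B e f` for a hyperbolic pair `(e, f)`. -/
def planeOrthogonalProj (hA : B.IsAlt) (hef : B e f = 1) : V →ₗ[k] planeOrthogonal B e f :=
  LinearMap.codRestrict _
    (LinearMap.id + (B f).smulRight e - (B e).smulRight f)
    (fun x => by simpa using planeOrthogonal_proj_mem hA hef x)

theorem coe_planeOrthogonalProj (hA : B.IsAlt) (hef : B e f = 1) (x : V) :
    (planeOrthogonalProj hA hef x : V) = x + B f x • e - B e x • f := rfl

theorem finrank_planeOrthogonal [FiniteDimensional k V] (hA : B.IsAlt) (hef : B e f = 1) :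
    Module.finrank k (planeOrthogonal B e f) + 2 = Module.finrank k V := by
  have h1 := LinearMap.finrank_range_add_finrank_ker ((B e).prod (B f))
  have h2 : LinearMap.range ((B e).prod (B f)) = ⊤ := by
    rw [LinearMap.range_eq_top]
    rintro ⟨a, b⟩
    have := isAlt_apply_swap hA hef
    exact ⟨a • f - b • e, by simp [hA.self_eq_zero, hef, this]⟩
  rw [h2, finrank_top, Module.finrank_prod, Module.finrank_self] at h1
  rw [planeOrthogonal]
  omega

/-- A vector of the complement pairs with `y` exactly as it pairs with the projection of `y`. -/
theorem planeOrthogonal_nondegenerate (hA : B.IsAlt) (hef : B e f = 1)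
    (hB : ∀ x, (∀ y, B x y = 0) → x = 0) (x : planeOrthogonal B e f)
    (hx : ∀ y : planeOrthogonal B e f, B x y = 0) : x = 0 := by
  refine Subtype.ext (hB x fun y => ?_)
  have h := hx (planeOrthogonalProj hA hef y)
  obtain ⟨h1, h2⟩ := mem_planeOrthogonal.1 x.2
  rw [coe_planeOrthogonalProj] at h
  simpa [← hA.neg e, ← hA.neg f, h1, h2] using h

theorem apply_eq_planeOrthogonal (hA : B.IsAlt) (hef : B e f = 1) (x y : V) :
    B x y = B (planeOrthogonalProj hA hef x) (planeOrthogonalProj hA hef y)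
      + B e x * B f y - B f x * B e y := by
  have := isAlt_apply_swap hA hef
  simp only [coe_planeOrthogonalProj, map_add, map_sub, map_smul, LinearMap.add_apply,
    LinearMap.sub_apply, LinearMap.smul_apply, smul_eq_mul, hA.self_eq_zero, hef, this,
    ← hA.neg e x, ← hA.neg f x]
  ring

end Plane

/-- Two nondegenerate alternating spaces of the same finite dimension are isometric. -/
theorem exists_isometry_of_finrank_eq (d : ℕ) :
    ∀ {V W : Type*} [AddCommGroup V] [Module k V] [FiniteDimensional k V]
    [AddCommGroup W] [Module k W] [FiniteDimensional k W]
    (B : V →ₗ[k] V →ₗ[k] k) (B' : W →ₗ[k] W →ₗ[k] k), B.IsAlt → B'.IsAlt →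
    (∀ x, (∀ y, B x y = 0) → x = 0) → (∀ x, (∀ y, B' x y = 0) → x = 0) →
    Module.finrank k V = d → Module.finrank k W = d →
    ∃ f : V →ₗ[k] W, ∀ x y, B' (f x) (f y) = B x y := by
  induction d using Nat.strong_induction_on with
  | _ d ih =>
    intro V W _ _ _ _ _ _ B B' hA hA' hB hB' hV hW
    rcases Nat.eq_zero_or_pos d with rfl | hd
    · have : Subsingleton V := Module.finrank_zero_iff.1 hV
      refine ⟨0, fun x y => ?_⟩
      simp [Subsingleton.elim x 0]
    · have : Nontrivial V := Module.nontrivial_of_finrank_pos (R := k) (by omega)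
      have : Nontrivial W := Module.nontrivial_of_finrank_pos (R := k) (by omega)
      obtain ⟨e, f, hef⟩ := exists_hyperbolic_pair hB
      obtain ⟨e', f', hef'⟩ := exists_hyperbolic_pair hB'
      have h1 := finrank_planeOrthogonal hA hef
      have h2 := finrank_planeOrthogonal hA' hef'
      obtain ⟨g, hg⟩ := ih (d - 2) (by omega)
        (B.domRestrict₁₂ (planeOrthogonal B e f) (planeOrthogonal B e f))
        (B'.domRestrict₁₂ (planeOrthogonal B' e' f') (planeOrthogonal B' e' f'))
        (fun x => hA x) (fun x => hA' x)
        (planeOrthogonal_nondegenerate hA hef hB)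
        (planeOrthogonal_nondegenerate hA' hef' hB') (by omega) (by omega)
      simp only [LinearMap.domRestrict₁₂_apply] at hg
      -- The coordinates of `x` along `e` and `f` are `-B f x` and `B e x`, so this map extends `g`
      -- by `e ↦ e'`, `f ↦ f'`.
      refine ⟨(planeOrthogonal B' e' f').subtype ∘ₗ g ∘ₗ planeOrthogonalProj hA hef
        - (B f).smulRight e' + (B e).smulRight f', fun x y => ?_⟩
      have hs := isAlt_apply_swap hA' hef'
      have ho : ∀ z : planeOrthogonal B' e' f', B' e' z = 0 ∧ B' f' z = 0 :=
        fun z => mem_planeOrthogonal.1 z.2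
      have ho' : ∀ z : planeOrthogonal B' e' f', B' z e' = 0 ∧ B' z f' = 0 := fun z => by
        rw [← hA'.neg, ← hA'.neg f', (ho z).1, (ho z).2]; simp
      rw [apply_eq_planeOrthogonal hA hef x y, ← hg]
      simp only [LinearMap.add_apply, LinearMap.sub_apply, LinearMap.comp_apply,
        LinearMap.smulRight_apply, Submodule.subtype_apply, map_add, map_sub, map_smul,
        LinearMap.smul_apply, smul_eq_mul, hA'.self_eq_zero, hef', hs, (ho _).1, (ho _).2,
        (ho' _).1, (ho' _).2]
      ring

/-- An alternating space maps isometrically onto a nondegenerate alternating space whose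
dimension is the rank of the form. -/
theorem exists_isometry_surjective {V W : Type*} [AddCommGroup V] [Module k V]
    [FiniteDimensional k V] [AddCommGroup W] [Module k W] [FiniteDimensional k W]
    (B : V →ₗ[k] V →ₗ[k] k) (B' : W →ₗ[k] W →ₗ[k] k) (hA : B.IsAlt) (hA' : B'.IsAlt)
    (hB' : ∀ x, (∀ y, B' x y = 0) → x = 0)
    (hd : Module.finrank k V = Module.finrank k (LinearMap.ker B) + Module.finrank k W) :
    ∃ f : V →ₗ[k] W, Function.Surjective f ∧ ∀ x y, B' (f x) (f y) = B x y := by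
  -- The form is nondegenerate on any complement `U` of the radical, and `dim U = dim W`. The
  -- required map is the projection onto `U` along the radical, followed by an isometry.
  obtain ⟨U, hU⟩ := (LinearMap.ker B).exists_isCompl
  have hker : ∀ r ∈ LinearMap.ker B, ∀ y, B r y = 0 ∧ B y r = 0 := fun r hr y => by
    have : B r y = 0 := by rw [LinearMap.mem_ker.1 hr]; rfl
    exact ⟨this, by rw [← hA.neg, this, neg_zero]⟩
  have hdec : ∀ y : V, ∃ u : U, ∃ r ∈ LinearMap.ker B, r + u = y := fun y => by
    obtain ⟨r, hr, u, hu, h⟩ := Submodule.mem_sup.1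
      (hU.sup_eq_top ▸ Submodule.mem_top : y ∈ LinearMap.ker B ⊔ U)
    exact ⟨⟨u, hu⟩, r, hr, h⟩
  have hnd : ∀ x : U, (∀ y : U, B x y = 0) → x = 0 := fun x hx => by
    have : (x : V) ∈ LinearMap.ker B := by
      refine LinearMap.mem_ker.2 (LinearMap.ext fun y => ?_)
      obtain ⟨u, r, hr, rfl⟩ := hdec y
      rw [map_add, (hker r hr _).2, hx u, zero_add, LinearMap.zero_apply]
    exact Subtype.ext ((Submodule.disjoint_def.1 hU.disjoint) _ this x.2)
  have hfr := Submodule.finrank_add_eq_of_isCompl hU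
  obtain ⟨g, hg⟩ := exists_isometry_of_finrank_eq (Module.finrank k W)
    (B.domRestrict₁₂ U U) B' (fun x => hA x) hA' hnd hB' (by omega) rfl
  simp only [LinearMap.domRestrict₁₂_apply] at hg
  have hinj : Function.Injective g := by
    rw [← LinearMap.ker_eq_bot, LinearMap.ker_eq_bot']
    intro x hx
    refine hnd x fun y => ?_
    rw [← hg, hx, map_zero, LinearMap.zero_apply]
  have hsurj : Function.Surjective g :=
    (LinearMap.injective_iff_surjective_of_finrank_eq_finrank (by omega)).1 hinj
  refine ⟨g ∘ₗ U.projectionOnto _ hU.symm, ?_, fun x y => ?_⟩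
  · exact hsurj.comp (Submodule.projectionOnto_surjective hU.symm)
  · obtain ⟨u, r, hr, rfl⟩ := hdec x
    obtain ⟨v, s, hs, rfl⟩ := hdec y
    simp only [LinearMap.comp_apply, map_add, hg, LinearMap.add_apply, (hker r hr _).1,
      (hker s hs _).2, zero_add]
    rw [(Submodule.projectionOnto_apply_eq_zero_iff hU.symm).2 hr,
      (Submodule.projectionOnto_apply_eq_zero_iff hU.symm).2 hs]
    simp

end Alternating

/-! ### The algebra of Pauli operators -/

section PauliAlgebra

variable (p : ℕ) [Fact p.Prime] {K : Type*} [Field K] [Fintype K] [DecidableEq K]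
  [Algebra (ZMod p) K] {ι : Type*} [Fintype ι] [DecidableEq ι]

/-- The character `x ↦ ω^{tr x}`. -/
noncomputable def traceChar (K : Type*) [Field K] [Algebra (ZMod p) K] : AddChar K ℂ :=
  (ZMod.stdAddChar (N := p)).compAddMonoidHom (Algebra.trace (ZMod p) K).toAddMonoidHom

theorem traceChar_apply (x : K) :
    traceChar p K x = ZMod.stdAddChar (Algebra.trace (ZMod p) K x) := rfl

theorem traceChar_eq_one_iff (x : K) : traceChar p K x = 1 ↔ Algebra.trace (ZMod p) K x = 0 := by
  rw [traceChar_apply, ← AddChar.map_zero_eq_one (ZMod.stdAddChar (N := p))]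
  exact ZMod.injective_stdAddChar.eq_iff

theorem star_traceChar (x : K) : star (traceChar p K x) = traceChar p K (-x) := by
  rw [AddChar.map_neg_eq_conj]
  rfl

theorem exists_trace_mul_ne_zero {x : K} (hx : x ≠ 0) :
    ∃ y, Algebra.trace (ZMod p) K (x * y) ≠ 0 := by
  by_contra! h
  exact hx ((traceForm_nondegenerate (ZMod p) K).1 x h)

theorem exists_trace_dotProduct_ne_zero {b : ι → K} (hb : b ≠ 0) :
    ∃ a, Algebra.trace (ZMod p) K (b ⬝ᵥ a) ≠ 0 := by
  obtain ⟨i, hi⟩ := Function.ne_iff.1 hb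
  obtain ⟨y, hy⟩ := exists_trace_mul_ne_zero p hi
  exact ⟨Pi.single i y, by simpa using hy⟩

theorem sum_traceChar_dotProduct (b : ι → K) :
    ∑ j, traceChar p K (b ⬝ᵥ j) = if b = 0 then (Fintype.card K : ℂ) ^ Fintype.card ι else 0 := by
  split_ifs with hb
  · subst hb
    simp [AddChar.map_zero_eq_one]
  · let χ : AddChar (ι → K) ℂ :=
      { toFun := fun j => traceChar p K (b ⬝ᵥ j)
        map_zero_eq_one' := by simp
        map_add_eq_mul' := fun x y => by rw [dotProduct_add, AddChar.map_add_eq_mul] }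
    obtain ⟨a, ha⟩ := exists_trace_dotProduct_ne_zero p hb
    refine AddChar.sum_eq_zero_of_ne_one (ψ := χ) fun h => ha ?_
    rw [← traceChar_eq_one_iff]
    exact DFunLike.congr_fun h a

/-- The trace symplectic form on the phase space. -/
noncomputable def symplecticForm (K ι : Type*) [Field K] [Algebra (ZMod p) K] [Fintype ι] :
    PhaseSpace K ι →ₗ[ZMod p] PhaseSpace K ι →ₗ[ZMod p] ZMod p :=
  LinearMap.mk₂ (ZMod p)
    (fun s t => Algebra.trace (ZMod p) K (s.2 ⬝ᵥ t.1) - Algebra.trace (ZMod p) K (t.2 ⬝ᵥ s.1))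
    (fun s s' t => by simp [add_dotProduct, dotProduct_add]; ring)
    (fun c s t => by simp [smul_dotProduct, dotProduct_smul, mul_sub])
    (fun s t t' => by simp [add_dotProduct, dotProduct_add]; ring)
    (fun c s t => by simp [smul_dotProduct, dotProduct_smul, mul_sub])

theorem symplecticForm_apply (s t : PhaseSpace K ι) :
    symplecticForm p K ι s t =
      Algebra.trace (ZMod p) K (s.2 ⬝ᵥ t.1) - Algebra.trace (ZMod p) K (t.2 ⬝ᵥ s.1) := rfl

theorem symplecticForm_isAlt : (symplecticForm p K ι).IsAlt := fun s => by
  rw [symplecticForm_apply, sub_self]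

theorem symplecticForm_nondegenerate (s : PhaseSpace K ι)
    (h : ∀ t, symplecticForm p K ι s t = 0) : s = 0 := by
  by_contra hs
  by_cases h2 : s.2 = 0
  · have h1 : s.1 ≠ 0 := fun h1 => hs (Prod.ext h1 h2)
    obtain ⟨a, ha⟩ := exists_trace_dotProduct_ne_zero p h1
    have := h (0, a)
    rw [symplecticForm_apply, dotProduct_comm a] at this
    simp only [dotProduct_zero, map_zero, zero_sub, neg_eq_zero] at this
    exact ha this
  · obtain ⟨a, ha⟩ := exists_trace_dotProduct_ne_zero p h2
    have := h (a, 0)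
    rw [symplecticForm_apply] at this
    simp only [zero_dotProduct, map_zero, sub_zero] at this
    exact ha this

theorem symplecticForm_sumElim {κ : Type*} [Fintype κ] (s t : PhaseSpace K ι)
    (s' t' : PhaseSpace K κ) :
    symplecticForm p K (ι ⊕ κ) (Sum.elim s.1 s'.1, Sum.elim s.2 s'.2)
      (Sum.elim t.1 t'.1, Sum.elim t.2 t'.2) =
      symplecticForm p K ι s t + symplecticForm p K κ s' t' := by
  simp only [symplecticForm_apply, sumElim_dotProduct_sumElim, map_add]
  ring

theorem pauli_apply (s : PhaseSpace K ι) (i j : ι → K) :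
    pauli p s i j = if i = j + s.1 then traceChar p K (s.2 ⬝ᵥ j) else 0 := rfl

theorem pauli_mulVec (s : PhaseSpace K ι) (v : (ι → K) → ℂ) (i : ι → K) :
    (pauli p s *ᵥ v) i = traceChar p K (s.2 ⬝ᵥ (i - s.1)) * v (i - s.1) := by
  rw [Matrix.mulVec, dotProduct, Finset.sum_eq_single (i - s.1)]
  · rw [pauli_apply, if_pos (by simp)]
  · intro j _ hj
    rw [pauli_apply, if_neg, zero_mul]
    rintro rfl
    simp at hj
  · simp

theorem pauli_mul_pauli (s t : PhaseSpace K ι) :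
    pauli p s * pauli p t = traceChar p K (s.2 ⬝ᵥ t.1) • pauli p (s + t) := by
  ext i j
  rw [Matrix.mul_apply, Finset.sum_eq_single (j + t.1)]
  · simp only [pauli_apply, Matrix.smul_apply, smul_eq_mul, Prod.fst_add, Prod.snd_add, if_true,
      add_dotProduct, dotProduct_add, AddChar.map_add_eq_mul]
    rw [show j + t.1 + s.1 = j + (s.1 + t.1) by abel]
    split_ifs <;> ring
  · intro x _ hx
    rw [pauli_apply p t, if_neg hx, mul_zero]
  · simp

theorem pauli_zero : pauli p (0 : PhaseSpace K ι) = 1 := by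
  ext i j
  simp [pauli_apply, Matrix.one_apply]

theorem conjTranspose_pauli (s : PhaseSpace K ι) :
    (pauli p s)ᴴ = traceChar p K (s.2 ⬝ᵥ s.1) • pauli p (-s) := by
  ext i j
  rw [Matrix.conjTranspose_apply, Matrix.smul_apply, pauli_apply, pauli_apply]
  by_cases h : j = i + s.1
  · subst h
    rw [if_pos rfl, if_pos (by simp), star_traceChar, smul_eq_mul, ← AddChar.map_add_eq_mul]
    congr 1
    simp [dotProduct_add]
  · rw [if_neg h, if_neg, star_zero, smul_zero]
    rintro rfl
    simp at h

theorem conjTranspose_pauli_mul_pauli (s : PhaseSpace K ι) : (pauli p s)ᴴ * pauli p s = 1 := by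
  rw [conjTranspose_pauli, Matrix.smul_mul, pauli_mul_pauli, smul_smul, ← AddChar.map_add_eq_mul,
    neg_add_cancel, pauli_zero]
  simp

theorem pauli_comm (s t : PhaseSpace K ι) :
    pauli p s * pauli p t =
      ZMod.stdAddChar (symplecticForm p K ι s t) • (pauli p t * pauli p s) := by
  rw [pauli_mul_pauli, pauli_mul_pauli, smul_smul, add_comm t s]
  congr 1
  rw [traceChar_apply, traceChar_apply, ← AddChar.map_add_eq_mul, symplecticForm_apply,
    sub_add_cancel]

theorem pauli_commute {s t : PhaseSpace K ι} (h : symplecticForm p K ι s t = 0) :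
    pauli p s * pauli p t = pauli p t * pauli p s := by
  rw [pauli_comm, h, AddChar.map_zero_eq_one, one_smul]

/-- Orthogonality of the Pauli operators under the trace: a shift by `a ≠ 0` has empty diagonal, and
for `a = 0` the trace is a character sum. The uniqueness of labels, the dimension formula and the
undetected errors all rest on it. -/
theorem trace_pauli (s : PhaseSpace K ι) :
    (pauli p s).trace = if s = 0 then (Fintype.card K : ℂ) ^ Fintype.card ι else 0 := by
  simp only [Matrix.trace, Matrix.diag_apply, pauli_apply, left_eq_add]
  by_cases h1 : s.1 = 0
  · simp only [h1, if_true, sum_traceChar_dotProduct, Prod.ext_iff, Prod.fst_zero, Prod.snd_zero,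
      true_and]
  · simp [h1, Prod.ext_iff]

/-- Otherwise the identity, as the product of `(pauli p s)ᴴ` with `z • pauli p t`, would be a
multiple of a traceless Pauli operator. -/
theorem eq_of_pauli_eq_smul {s t : PhaseSpace K ι} {z : ℂ} (h : pauli p s = z • pauli p t) :
    s = t := by
  have h1 := trace_pauli p (0 : PhaseSpace K ι)
  rw [pauli_zero, ← conjTranspose_pauli_mul_pauli p s] at h1
  nth_rw 2 [h] at h1
  rw [conjTranspose_pauli, Matrix.smul_mul, Matrix.mul_smul, pauli_mul_pauli, Matrix.trace_smul,
    Matrix.trace_smul, Matrix.trace_smul, trace_pauli, if_pos rfl] at h1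
  by_contra hst
  rw [if_neg fun h0 => hst (neg_add_eq_zero.1 h0), smul_zero, smul_zero, smul_zero] at h1
  exact pow_ne_zero _ (Nat.cast_ne_zero.2 Fintype.card_ne_zero) h1.symm

end PauliAlgebra

/-! ### Stabilizer groups -/

/-- A commuting family of endomorphisms of a nontrivial finite-dimensional space over an
algebraically closed field has a common eigenvector. -/
theorem exists_common_eigenvector {k V I : Type*} [Field k] [IsAlgClosed k] [AddCommGroup V]
    [Module k V] [FiniteDimensional k V] [Nontrivial V] (f : I → Module.End k V)
    (hf : ∀ i j, Commute (f i) (f j)) : ∃ v ≠ 0, ∀ i, ∃ μ : k, f i v = μ • v := by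
  let P : Submodule k V → Prop := fun U => U ≠ ⊥ ∧ ∀ i, ∀ u ∈ U, f i u ∈ U
  -- `U` is a nonzero common invariant subspace of least dimension; every operator turns out to be
  -- scalar on it.
  obtain ⟨U, ⟨hU, hinv⟩, hmin⟩ := WellFounded.has_min
    (InvImage.wf (fun U : Submodule k V => Module.finrank k U) Nat.lt_wfRel.wf) {U | P U}
    ⟨⊤, top_ne_bot, fun _ _ _ => trivial⟩
  obtain ⟨v, hv, hv0⟩ := (Submodule.ne_bot_iff U).1 hU
  refine ⟨v, hv0, fun i => ?_⟩
  have : Nontrivial U := (Submodule.nontrivial_iff_ne_bot).2 hU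
  obtain ⟨μ, hμ⟩ := Module.End.exists_eigenvalue ((f i).restrict (hinv i))
  obtain ⟨u, hu⟩ := hμ.exists_hasEigenvector
  have hu1 : f i u = μ • (u : V) := congrArg Subtype.val hu.apply_eq_smul
  -- By commutativity the eigenspace of `f i` in `U` is invariant under every `f j`, so minimality
  -- makes it all of `U`.
  have hW : P (U ⊓ (f i).eigenspace μ) := by
    refine ⟨(Submodule.ne_bot_iff _).2 ⟨u, ⟨u.2, Module.End.mem_eigenspace_iff.2 hu1⟩,
      fun h => hu.2 (Subtype.ext h)⟩, fun j w hw => ⟨hinv j w hw.1, ?_⟩⟩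
    have h := Module.End.mem_eigenspace_iff.1 hw.2
    refine Module.End.mem_eigenspace_iff.2 ?_
    have hc : f i (f j w) = f j (f i w) := LinearMap.congr_fun (hf i j).eq w
    rw [hc, h, map_smul]
  have hle : ¬ Module.finrank k (U ⊓ (f i).eigenspace μ : Submodule k V) < Module.finrank k U :=
    hmin _ hW
  have heq := Submodule.eq_of_le_of_finrank_le (inf_le_left : U ⊓ (f i).eigenspace μ ≤ U)
    (not_lt.1 hle)
  exact ⟨μ, Module.End.mem_eigenspace_iff.1 (heq.ge hv).2⟩

section Stabilizer

variable {p : ℕ} [Fact p.Prime] {K : Type*} [Field K] [Fintype K] [DecidableEq K]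
  [Algebra (ZMod p) K] {ι : Type*} [Fintype ι] [DecidableEq ι]

open scoped ComplexOrder in
theorem star_mul_self_eq_one_of_pauli_mulVec {s : PhaseSpace K ι} {v : (ι → K) → ℂ} (hv : v ≠ 0)
    {μ : ℂ} (h : pauli p s *ᵥ v = μ • v) : star μ * μ = 1 := by
  have h1 : star (pauli p s *ᵥ v) ⬝ᵥ (pauli p s *ᵥ v) = star v ⬝ᵥ v := by
    rw [Matrix.star_mulVec, ← Matrix.dotProduct_mulVec, Matrix.mulVec_mulVec,
      conjTranspose_pauli_mul_pauli, Matrix.one_mulVec]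
  rw [h, star_smul, smul_dotProduct, dotProduct_smul, smul_smul] at h1
  exact (mul_eq_right₀ (mt dotProduct_star_self_eq_zero.1 hv)).1 h1

/-- The elements of the Pauli group over a set of phase space points that fix a vector. -/
def pauliStabilizer (p : ℕ) [Fact p.Prime] {K : Type*} [Field K] [Fintype K] [DecidableEq K]
    [Algebra (ZMod p) K] {ι : Type*} [Fintype ι] [DecidableEq ι]
    (S : AddSubgroup (PhaseSpace K ι)) (v : (ι → K) → ℂ) :
    Subgroup (Matrix.unitaryGroup (ι → K) ℂ) where
  carrier := {g | (∃ (z : ℂ), ∃ s ∈ S, (g : Matrix (ι → K) (ι → K) ℂ) = z • pauli p s) ∧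
    (g : Matrix (ι → K) (ι → K) ℂ) *ᵥ v = v}
  one_mem' := ⟨⟨1, 0, S.zero_mem, by simp [pauli_zero]⟩, by simp⟩
  mul_mem' := by
    rintro g h ⟨⟨z, s, hs, hg⟩, hgv⟩ ⟨⟨w, t, ht, hh⟩, hhv⟩
    refine ⟨⟨z * w * traceChar p K (s.2 ⬝ᵥ t.1), s + t, S.add_mem hs ht, ?_⟩, ?_⟩
    · rw [Matrix.UnitaryGroup.mul_val, hg, hh, Matrix.smul_mul, Matrix.mul_smul, pauli_mul_pauli,
        smul_smul, smul_smul, mul_assoc]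
    · rw [Matrix.UnitaryGroup.mul_val, ← Matrix.mulVec_mulVec, hhv, hgv]
  inv_mem' := by
    rintro g ⟨⟨z, s, hs, hg⟩, hgv⟩
    refine ⟨⟨star z * traceChar p K (s.2 ⬝ᵥ s.1), -s, S.neg_mem hs, ?_⟩, ?_⟩
    · rw [Matrix.UnitaryGroup.inv_val, hg, Matrix.star_eq_conjTranspose,
        Matrix.conjTranspose_smul, conjTranspose_pauli, smul_smul]
    · nth_rw 1 [← hgv]
      rw [Matrix.mulVec_mulVec, ← Matrix.UnitaryGroup.mul_val, inv_mul_cancel,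
        Matrix.UnitaryGroup.one_val, Matrix.one_mulVec]

/-- A scalar that fixes a nonzero vector is `1`. -/
theorem isStabilizerGroup_pauliStabilizer {S : AddSubgroup (PhaseSpace K ι)}
    (hS : ∀ s ∈ S, ∀ t ∈ S, symplecticForm p K ι s t = 0) {v : (ι → K) → ℂ} (hv : v ≠ 0) :
    IsStabilizerGroup p (pauliStabilizer p S v) where
  isPauli := by
    rintro g ⟨⟨z, s, _, hg⟩, _⟩
    exact ⟨z, s, hg⟩
  comm := by
    rintro g ⟨⟨z, s, hs, hg⟩, _⟩ h ⟨⟨w, t, ht, hh⟩, _⟩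
    refine Subtype.ext ?_
    rw [Matrix.UnitaryGroup.mul_val, Matrix.UnitaryGroup.mul_val, hg, hh, Matrix.smul_mul,
      Matrix.mul_smul, Matrix.smul_mul, Matrix.mul_smul, pauli_commute p (hS s hs t ht),
      smul_comm]
  scalar := by
    rintro g ⟨_, hgv⟩ z hz
    rw [hz, Matrix.smul_mulVec, Matrix.one_mulVec] at hgv
    by_contra h
    have : (z - 1) • v = 0 := by rw [sub_smul, hgv, one_smul, sub_self]
    exact (smul_ne_zero (sub_ne_zero.2 h) hv) this

/-- Every isotropic subgroup of the phase space lifts to a stabilizer group. -/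
theorem exists_isStabilizerGroup (S : AddSubgroup (PhaseSpace K ι))
    (hS : ∀ s ∈ S, ∀ t ∈ S, symplecticForm p K ι s t = 0) :
    ∃ T : Subgroup (Matrix.unitaryGroup (ι → K) ℂ), IsStabilizerGroup p T ∧
      tauImage p T = (S : Set (PhaseSpace K ι)) := by
  -- The common eigenvector chooses all phases consistently: above `s` with eigenvalue `μ` lies
  -- `star μ • pauli p s`, which fixes `v`. This treats all primes alike, including `p = 2`.
  obtain ⟨v, hv, hμ⟩ := exists_common_eigenvector
    (fun s : S => Matrix.toLin' (pauli p (s : PhaseSpace K ι))) fun s t => by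
      rw [Commute, SemiconjBy, Module.End.mul_eq_comp, Module.End.mul_eq_comp, ← Matrix.toLin'_mul,
        ← Matrix.toLin'_mul,
        pauli_commute p (hS s s.2 t t.2)]
  refine ⟨pauliStabilizer p S v, isStabilizerGroup_pauliStabilizer hS hv, Set.ext fun s => ?_⟩
  constructor
  · rintro ⟨g, ⟨⟨z, t, ht, hg⟩, hgv⟩, w, hw⟩
    rw [hg] at hw
    have hz : z ≠ 0 := by
      rintro rfl
      rw [hg, zero_smul, Matrix.zero_mulVec] at hgv
      exact hv hgv.symm
    have : pauli p t = (z⁻¹ * w) • pauli p s := by rw [mul_smul, ← hw, inv_smul_smul₀ hz]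
    rwa [← eq_of_pauli_eq_smul p this]
  · intro hs
    obtain ⟨μ, h⟩ := hμ ⟨s, hs⟩
    rw [Matrix.toLin'_apply] at h
    have hn := star_mul_self_eq_one_of_pauli_mulVec hv h
    have hu : star μ • pauli p s ∈ Matrix.unitaryGroup (ι → K) ℂ := by
      rw [Matrix.mem_unitaryGroup_iff', Matrix.star_eq_conjTranspose, Matrix.conjTranspose_smul,
        star_star, Matrix.smul_mul, Matrix.mul_smul, conjTranspose_pauli_mul_pauli, smul_smul,
        mul_comm, hn, one_smul]
    refine ⟨⟨_, hu⟩, ⟨⟨star μ, s, hs, rfl⟩, ?_⟩, star μ, rfl⟩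
    simp only [Matrix.smul_mulVec]
    rw [h, smul_smul, hn, one_smul]

/-! ### The projection onto the stabilized space, and its dimension. -/

section Projection

variable {T : Subgroup (Matrix.unitaryGroup (ι → K) ℂ)}

theorem star_mul_self_of_eq_smul_pauli {g : Matrix.unitaryGroup (ι → K) ℂ} {z : ℂ}
    {s : PhaseSpace K ι} (h : (g : Matrix (ι → K) (ι → K) ℂ) = z • pauli p s) :
    star z * z = 1 := by
  have h1 := Matrix.mem_unitaryGroup_iff'.1 g.2
  rw [h, Matrix.star_eq_conjTranspose, Matrix.conjTranspose_smul, Matrix.smul_mul,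
    Matrix.mul_smul, conjTranspose_pauli_mul_pauli, smul_smul] at h1
  have h2 := congrFun (congrFun h1 0) 0
  simpa using h2

theorem ne_zero_of_eq_smul_pauli {g : Matrix.unitaryGroup (ι → K) ℂ} {z : ℂ}
    {s : PhaseSpace K ι} (h : (g : Matrix (ι → K) (ι → K) ℂ) = z • pauli p s) : z ≠ 0 := by
  rintro rfl
  simpa using star_mul_self_of_eq_smul_pauli h

/-- The quotient of two elements above the same point is scalar, hence the identity; so `τ` is
injective on a stabilizer group. -/
theorem IsStabilizerGroup.eq_of_smul_eq (hT : IsStabilizerGroup p T)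
    {g h : Matrix.unitaryGroup (ι → K) ℂ} (hg : g ∈ T) (hh : h ∈ T) {z w : ℂ}
    {s : PhaseSpace K ι} (hgs : (g : Matrix (ι → K) (ι → K) ℂ) = z • pauli p s)
    (hhs : (h : Matrix (ι → K) (ι → K) ℂ) = w • pauli p s) : g = h := by
  have h1 : ((h⁻¹ * g : Matrix.unitaryGroup (ι → K) ℂ) : Matrix (ι → K) (ι → K) ℂ) =
      (star w * z) • 1 := by
    rw [Matrix.UnitaryGroup.mul_val, Matrix.UnitaryGroup.inv_val, hgs, hhs,
      Matrix.star_eq_conjTranspose, Matrix.conjTranspose_smul, Matrix.smul_mul, Matrix.mul_smul,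
      conjTranspose_pauli_mul_pauli, smul_smul]
  have h2 := hT.scalar _ (T.mul_mem (T.inv_mem hh) hg) _ h1
  rw [h2, one_smul] at h1
  exact (inv_mul_eq_one.1 (Subtype.ext h1)).symm

theorem exists_equiv_tauImage (hT : IsStabilizerGroup p T) :
    ∃ e : T ≃ tauImage p T, ∀ g : T, ∃ z : ℂ,
      ((g : Matrix.unitaryGroup (ι → K) ℂ) : Matrix (ι → K) (ι → K) ℂ) =
        z • pauli p (e g : PhaseSpace K ι) := by
  choose z s hs using fun g : T => hT.isPauli g g.2
  refine ⟨Equiv.ofBijective (fun g => ⟨s g, g, g.2, z g, hs g⟩) ⟨fun g h hgh => ?_, ?_⟩,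
    fun g => ⟨z g, hs g⟩⟩
  · have hst : s g = s h := congrArg Subtype.val hgh
    have h1 := hs g
    rw [hst] at h1
    exact Subtype.ext (hT.eq_of_smul_eq g.2 h.2 h1 (hs h))
  · rintro ⟨t, g, hg, w, hw⟩
    refine ⟨⟨g, hg⟩, Subtype.ext ?_⟩
    have hz := ne_zero_of_eq_smul_pauli (hs ⟨g, hg⟩)
    have h1 : pauli p (s ⟨g, hg⟩) = ((z ⟨g, hg⟩)⁻¹ * w) • pauli p t := by
      rw [mul_smul, ← hw]
      change _ = _ • ((⟨g, hg⟩ : T) : Matrix.unitaryGroup (ι → K) ℂ).1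
      rw [hs ⟨g, hg⟩, inv_smul_smul₀ hz]
    exact eq_of_pauli_eq_smul p h1

theorem IsStabilizerGroup.finite (hT : IsStabilizerGroup p T) : Finite T := by
  obtain ⟨e, _⟩ := exists_equiv_tauImage hT
  exact Finite.of_equiv _ e.symm

theorem IsStabilizerGroup.card_eq (hT : IsStabilizerGroup p T) :
    Nat.card T = Nat.card (tauImage p T) := by
  obtain ⟨e, _⟩ := exists_equiv_tauImage hT
  exact Nat.card_congr e

/-- The sum of the elements of a finite group of unitary matrices. -/
noncomputable def groupSum (T : Subgroup (Matrix.unitaryGroup (ι → K) ℂ)) [Fintype T] :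
    Matrix (ι → K) (ι → K) ℂ :=
  ∑ g : T, ((g : Matrix.unitaryGroup (ι → K) ℂ) : Matrix (ι → K) (ι → K) ℂ)

theorem mul_groupSum [Fintype T] (h : T) :
    ((h : Matrix.unitaryGroup (ι → K) ℂ) : Matrix (ι → K) (ι → K) ℂ) * groupSum T =
      groupSum T := by
  rw [groupSum, Finset.mul_sum]
  exact Fintype.sum_equiv (Equiv.mulLeft h) _ _ fun g => rfl

theorem isProj_groupSum [Fintype T] :
    LinearMap.IsProj (codeSpace T) (Matrix.toLin' ((Fintype.card T : ℂ)⁻¹ • groupSum T)) where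
  map_mem v g hg := by
    rw [Matrix.toLin'_apply, Matrix.mulVec_mulVec, Matrix.mul_smul, mul_groupSum ⟨g, hg⟩]
  map_id v hv := by
    have h : ∀ g : T, ((g : Matrix.unitaryGroup (ι → K) ℂ) : Matrix (ι → K) (ι → K) ℂ) *ᵥ v = v :=
      fun g => hv g g.2
    rw [Matrix.toLin'_apply, Matrix.smul_mulVec, groupSum, Matrix.sum_mulVec,
      Finset.sum_congr rfl fun g _ => h g, Finset.sum_const, Finset.card_univ,
      ← Nat.cast_smul_eq_nsmul ℂ, inv_smul_smul₀ (Nat.cast_ne_zero.2 Fintype.card_ne_zero)]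

theorem IsStabilizerGroup.trace_groupSum_mul_pauli [Fintype T] (hT : IsStabilizerGroup p T)
    {t : PhaseSpace K ι} (ht : -t ∉ tauImage p T) : (groupSum T * pauli p t).trace = 0 := by
  rw [groupSum, Finset.sum_mul, Matrix.trace_sum]
  refine Finset.sum_eq_zero fun g _ => ?_
  obtain ⟨z, s, hs⟩ := hT.isPauli g g.2
  rw [hs, Matrix.smul_mul, pauli_mul_pauli, Matrix.trace_smul, Matrix.trace_smul, trace_pauli,
    if_neg, smul_zero, smul_zero]
  intro h
  exact ht ⟨g, g.2, z, by rwa [← eq_neg_of_add_eq_zero_left h]⟩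

theorem IsStabilizerGroup.trace_groupSum [Fintype T] (hT : IsStabilizerGroup p T) :
    (groupSum T).trace = (Fintype.card K : ℂ) ^ Fintype.card ι := by
  rw [groupSum, Matrix.trace_sum, Finset.sum_eq_single 1]
  · change (1 : Matrix (ι → K) (ι → K) ℂ).trace = _
    rw [← pauli_zero p, trace_pauli, if_pos rfl]
  · intro g _ hg
    obtain ⟨z, s, hs⟩ := hT.isPauli g g.2
    rw [hs, Matrix.trace_smul, trace_pauli, if_neg, smul_zero]
    rintro rfl
    refine hg (Subtype.ext (hT.eq_of_smul_eq g.2 T.one_mem hs (w := 1) ?_))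
    rw [pauli_zero, one_smul]
    rfl
  · simp

/-- The dimension is the trace of the projection obtained by averaging the group, and only the
identity contributes to that trace. -/
theorem IsStabilizerGroup.finrank_codeSpace (hT : IsStabilizerGroup p T) :
    Nat.card (tauImage p T) * Module.finrank ℂ (codeSpace T) =
      Fintype.card K ^ Fintype.card ι := by
  have := hT.finite
  have := Fintype.ofFinite T
  have h := (isProj_groupSum (T := T)).trace
  rw [Matrix.trace_toLin'_eq, Matrix.trace_smul, hT.trace_groupSum, smul_eq_mul,
    inv_mul_eq_iff_eq_mul₀ (Nat.cast_ne_zero.2 Fintype.card_ne_zero)] at h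
  rw [← hT.card_eq, Nat.card_eq_fintype_card]
  exact_mod_cast h.symm

end Projection

end Stabilizer

/-! ### Detection of errors by stabilizer codes -/

section Detection

variable {p : ℕ} [Fact p.Prime] {K : Type*} [Field K] [Fintype K] [DecidableEq K]
  [Algebra (ZMod p) K] {ι : Type*} [Fintype ι] [DecidableEq ι]
  {T : Subgroup (Matrix.unitaryGroup (ι → K) ℂ)}

theorem conjTranspose_mulVec_of_mem_codeSpace {u : (ι → K) → ℂ} (hu : u ∈ codeSpace T)
    {g : Matrix.unitaryGroup (ι → K) ℂ} (hg : g ∈ T) :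
    (g : Matrix (ι → K) (ι → K) ℂ)ᴴ *ᵥ u = u :=
  hu g⁻¹ (T.inv_mem hg)

/-- Errors that do not commute with the stabilizer move the code into its orthogonal
complement. -/
theorem dotProduct_pauli_mulVec_eq_zero {e t : PhaseSpace K ι} (ht : t ∈ tauImage p T)
    (h : symplecticForm p K ι e t ≠ 0) {u v : (ι → K) → ℂ} (hu : u ∈ codeSpace T)
    (hv : v ∈ codeSpace T) : star u ⬝ᵥ (pauli p e *ᵥ v) = 0 := by
  obtain ⟨g, hg, z, hz⟩ := ht
  have h1 : pauli p e * (g : Matrix (ι → K) (ι → K) ℂ) =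
      (ZMod.stdAddChar (symplecticForm p K ι e t) : ℂ) •
        ((g : Matrix (ι → K) (ι → K) ℂ) * pauli p e) := by
    rw [hz, Matrix.mul_smul, Matrix.smul_mul, pauli_comm, smul_comm]
  -- Insert `g` in front of `v`, move it past the error and absorb it into `u`. The inner product
  -- reproduces itself times a root of unity different from `1`.
  have h2 : star u ⬝ᵥ (pauli p e *ᵥ v) =
      ZMod.stdAddChar (symplecticForm p K ι e t) * (star u ⬝ᵥ (pauli p e *ᵥ v)) := by
    conv_lhs => rw [← hv g hg]
    rw [Matrix.mulVec_mulVec, h1, Matrix.smul_mulVec, dotProduct_smul, ← Matrix.mulVec_mulVec,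
      Matrix.dotProduct_mulVec, ← Matrix.conjTranspose_conjTranspose
        (g : Matrix (ι → K) (ι → K) ℂ), ← Matrix.star_mulVec,
      conjTranspose_mulVec_of_mem_codeSpace hu hg, smul_eq_mul]
  by_contra h0
  have h3 : (ZMod.stdAddChar (symplecticForm p K ι e t) : ℂ) = 1 :=
    mul_right_cancel₀ h0 (by rw [← h2, one_mul])
  rw [← AddChar.map_zero_eq_one (ZMod.stdAddChar (N := p))] at h3
  exact h (ZMod.injective_stdAddChar h3)

theorem detects_of_symplecticForm_ne_zero {e t : PhaseSpace K ι} (ht : t ∈ tauImage p T)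
    (h : symplecticForm p K ι e t ≠ 0) : Detects (codeSpace T) (pauli p e) :=
  ⟨0, fun u hu v hv => by rw [dotProduct_pauli_mulVec_eq_zero ht h hu hv, zero_mul]⟩

theorem detects_of_mem_tauImage {e : PhaseSpace K ι} (he : e ∈ tauImage p T) :
    Detects (codeSpace T) (pauli p e) := by
  obtain ⟨g, hg, z, hz⟩ := he
  have hz0 := ne_zero_of_eq_smul_pauli hz
  refine ⟨z⁻¹, fun u _ v hv => ?_⟩
  have h : pauli p e = z⁻¹ • (g : Matrix (ι → K) (ι → K) ℂ) := by rw [hz, inv_smul_smul₀ hz0]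
  rw [h, Matrix.smul_mulVec, hv g hg, dotProduct_smul, smul_eq_mul]

theorem pauli_mulVec_mem_codeSpace (hT : IsStabilizerGroup p T) {e : PhaseSpace K ι}
    (h : ∀ t ∈ tauImage p T, symplecticForm p K ι e t = 0) {v : (ι → K) → ℂ}
    (hv : v ∈ codeSpace T) : pauli p e *ᵥ v ∈ codeSpace T := fun g hg => by
  obtain ⟨z, s, hz⟩ := hT.isPauli g hg
  have hc := pauli_commute p (h s ⟨g, hg, z, hz⟩)
  nth_rw 2 [← hv g hg]
  rw [Matrix.mulVec_mulVec, Matrix.mulVec_mulVec, hz, Matrix.smul_mul, Matrix.mul_smul, hc]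

-- An error commuting with the stabilizer preserves the code, so if detected it would act there as a
-- scalar `z`. Multiplying by `groupSum`, a multiple of the projection, and taking traces gives `z =
-- 0`, which contradicts unitarity.
open scoped ComplexOrder in
theorem not_detects (hT : IsStabilizerGroup p T) {e : PhaseSpace K ι}
    (h : ∀ t ∈ tauImage p T, symplecticForm p K ι e t = 0) (he : -e ∉ tauImage p T) :
    ¬ Detects (codeSpace T) (pauli p e) := by
  rintro ⟨z, hz⟩
  have := hT.finite
  have := Fintype.ofFinite T
  have h1 : ∀ v ∈ codeSpace T, pauli p e *ᵥ v = z • v := fun v hv => by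
    have h2 := pauli_mulVec_mem_codeSpace hT h hv
    have h3 := (codeSpace T).sub_mem h2 ((codeSpace T).smul_mem z hv)
    have h4 := hz _ h3 v hv
    rw [← sub_eq_zero, ← dotProduct_star_self_eq_zero]
    nth_rw 2 [sub_eq_add_neg]
    rw [dotProduct_add, dotProduct_neg, dotProduct_smul, h4, smul_eq_mul, add_neg_cancel]
  have h5 : pauli p e * groupSum T = z • groupSum T := by
    refine Matrix.ext_of_mulVec_single fun i => ?_
    rw [← Matrix.mulVec_mulVec, Matrix.smul_mulVec]
    refine h1 _ fun g hg => ?_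
    rw [Matrix.mulVec_mulVec, mul_groupSum ⟨g, hg⟩]
  have h6 : (groupSum T).trace ≠ 0 := by
    rw [hT.trace_groupSum]
    exact pow_ne_zero _ (Nat.cast_ne_zero.2 Fintype.card_ne_zero)
  have h7 : z = 0 := by
    have h8 := hT.trace_groupSum_mul_pauli he
    rw [Matrix.trace_mul_comm, h5, Matrix.trace_smul, smul_eq_mul] at h8
    exact (mul_eq_zero.1 h8).resolve_right h6
  rw [h7, zero_smul] at h5
  refine h6 ?_
  rw [← Matrix.one_mul (groupSum T), ← conjTranspose_pauli_mul_pauli p e, Matrix.mul_assoc, h5,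
    Matrix.mul_zero, Matrix.trace_zero]

end Detection

/-! ### The shape of entanglement-assisted codes -/

theorem exists_orthonormal_family {X I : Type*} [Fintype X] [Fintype I] [DecidableEq I]
    (Q : Submodule ℂ (X → ℂ)) (hQ : Module.finrank ℂ Q = Fintype.card I) :
    ∃ w : I → X → ℂ, (∀ i, w i ∈ Q) ∧
      (∀ i j, star (w i) ⬝ᵥ w j = if i = j then 1 else 0) ∧
      ∀ v, v ∈ Q ↔ ∃ ψ : I → ℂ, v = ∑ i, ψ i • w i := by
  let E := WithLp.linearEquiv 2 ℂ (X → ℂ)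
  let Q' : Submodule ℂ (EuclideanSpace ℂ X) := Q.comap E.toLinearMap
  have hf : Module.finrank ℂ Q' = Fintype.card I := by
    rw [← hQ]
    exact LinearEquiv.finrank_eq (E.submoduleMap Q' |>.trans
      (LinearEquiv.ofEq _ _ (Submodule.map_comap_eq_of_surjective E.surjective Q)))
  let b := (stdOrthonormalBasis ℂ Q').reindex
    ((finCongr hf).trans (Fintype.equivFin I).symm)
  refine ⟨fun i => E (b i : EuclideanSpace ℂ X), fun i => (b i).2, fun i j => ?_, fun v => ?_⟩
  · have h := orthonormal_iff_ite.1 b.orthonormal i j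
    rw [Submodule.coe_inner, EuclideanSpace.inner_eq_star_dotProduct, dotProduct_comm] at h
    exact h
  · constructor
    · intro hv
      let v' : Q' := ⟨E.symm v, by simpa [Q'] using hv⟩
      refine ⟨fun i => b.repr v' i, ?_⟩
      have h := congrArg (fun x : Q' => E (x : EuclideanSpace ℂ X)) (b.sum_repr v')
      simp only [Submodule.coe_sum, map_sum, Submodule.coe_smul, map_smul] at h
      rw [h]
      simp [v']
    · rintro ⟨ψ, rfl⟩
      exact Q.sum_mem fun i _ => Q.smul_mem _ (b i).2

section Receiver

variable {p : ℕ} [Fact p.Prime] {K : Type*} [Field K] [Fintype K] [DecidableEq K]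
  [Algebra (ZMod p) K] {ι κ : Type*} [Fintype ι] [DecidableEq ι] [Fintype κ] [DecidableEq κ]

/-- Juxtaposition of Pauli operators. -/
def joinPhase (K ι κ : Type*) [Field K] :
    PhaseSpace K ι × PhaseSpace K κ →+ PhaseSpace K (ι ⊕ κ) where
  toFun s := (Sum.elim s.1.1 s.2.1, Sum.elim s.1.2 s.2.2)
  map_zero' := by ext i <;> rcases i with i | i <;> rfl
  map_add' s t := by ext i <;> rcases i with i | i <;> rfl

theorem joinPhase_apply (s : PhaseSpace K ι) (t : PhaseSpace K κ) :
    joinPhase K ι κ (s, t) = (Sum.elim s.1 t.1, Sum.elim s.2 t.2) := rfl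

theorem joinPhase_injective : Function.Injective (joinPhase K ι κ) := by
  rintro ⟨s, s'⟩ ⟨t, t'⟩ h
  have h1 := congrArg Prod.fst h
  have h2 := congrArg Prod.snd h
  simp only [joinPhase_apply] at h1 h2
  ext i
  · exact congrFun h1 (Sum.inl i)
  · exact congrFun h2 (Sum.inl i)
  · exact congrFun h1 (Sum.inr i)
  · exact congrFun h2 (Sum.inr i)

theorem symplecticForm_joinPhase (s t : PhaseSpace K ι) (s' t' : PhaseSpace K κ) :
    symplecticForm p K (ι ⊕ κ) (joinPhase K ι κ (s, s')) (joinPhase K ι κ (t, t')) =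
      symplecticForm p K ι s t + symplecticForm p K κ s' t' :=
  symplecticForm_sumElim p s t s' t'

theorem dotProduct_receiver_pauli_mulVec (u v : (ι ⊕ κ → K) → ℂ) (e : PhaseSpace K κ) :
    star u ⬝ᵥ (pauli p (joinPhase K ι κ (0, e)) *ᵥ v) =
      ∑ y : κ → K, traceChar p K (e.2 ⬝ᵥ (y - e.1)) *
        ∑ x : ι → K, star (u (Sum.elim x y)) * v (Sum.elim x (y - e.1)) := by
  rw [dotProduct, ← (Equiv.sumArrowEquivProdArrow ι κ K).symm.sum_comp, Fintype.sum_prod_type,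
    Finset.sum_comm]
  refine Finset.sum_congr rfl fun y _ => ?_
  rw [Finset.mul_sum]
  refine Finset.sum_congr rfl fun x _ => ?_
  have h1 : (Equiv.sumArrowEquivProdArrow ι κ K).symm (x, y) = Sum.elim x y := rfl
  have h2 : Sum.elim x y - (Sum.elim (0 : ι → K) e.1) = Sum.elim x (y - e.1) := by
    ext i
    rcases i with i | i <;> simp
  rw [h1, pauli_mulVec, joinPhase_apply]
  simp only [Prod.fst_zero, Prod.snd_zero]
  rw [h2, sumElim_dotProduct_sumElim, zero_dotProduct, zero_add, Pi.star_apply]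
  ring

/-- If all nontrivial errors of the receiver are orthogonal to `u` and `v`, then the partial
inner product of `u` and `v` over the sender's system is a multiple of the identity. -/
theorem partial_inner_eq (u v : (ι ⊕ κ → K) → ℂ)
    (h : ∀ e : PhaseSpace K κ, e ≠ 0 →
      star u ⬝ᵥ (pauli p (joinPhase K ι κ (0, e)) *ᵥ v) = 0) (y y' : κ → K) :
    (Fintype.card K : ℂ) ^ Fintype.card κ *
      ∑ x : ι → K, star (u (Sum.elim x y)) * v (Sum.elim x y') =
        if y = y' then star u ⬝ᵥ v else 0 := by
  -- Fourier inversion over the `Z`-parts `b`, with the shift fixed at `y - y'`. By hypothesis only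
  -- the trivial error survives; by orthogonality of characters the same sum isolates the slices at
  -- `y` and `y'`.
  have h1 : ∑ b : κ → K, traceChar p K (-(b ⬝ᵥ y')) *
      star u ⬝ᵥ (pauli p (joinPhase K ι κ (0, (y - y', b))) *ᵥ v) =
        if y = y' then star u ⬝ᵥ v else 0 := by
    rw [Finset.sum_eq_single 0]
    · split_ifs with hy
      · have : (0, (y - y', 0)) = (0 : PhaseSpace K ι × PhaseSpace K κ) := by
          rw [hy, sub_self]; rfl
        rw [this, map_zero, pauli_zero, Matrix.one_mulVec]
        simp
      · rw [h _ fun h0 => hy (sub_eq_zero.1 (congrArg Prod.fst h0)), mul_zero]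
    · intro b _ hb
      rw [h _ fun h0 => hb (congrArg Prod.snd h0), mul_zero]
    · simp
  rw [← h1]
  simp only [dotProduct_receiver_pauli_mulVec, Finset.mul_sum (s := (Finset.univ : Finset (κ → K)))]
  rw [Finset.sum_comm, Finset.sum_eq_single y]
  · simp only [sub_sub_cancel, ← mul_assoc, ← AddChar.map_add_eq_mul, neg_add_cancel,
      AddChar.map_zero_eq_one, one_mul]
    simp
  · intro x _ hx
    simp only [← mul_assoc, ← AddChar.map_add_eq_mul]
    rw [← Finset.sum_mul]
    have : ∀ b : κ → K, -(b ⬝ᵥ y') + b ⬝ᵥ (x - (y - y')) = (x - y) ⬝ᵥ b := fun b => by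
      rw [dotProduct_comm (x - y), dotProduct_sub, dotProduct_sub, dotProduct_sub]
      ring
    simp only [this]
    rw [sum_traceChar_dotProduct, if_neg (sub_ne_zero.2 hx), zero_mul]
  · simp

end Receiver

/-- The columns of `V` are the slices, at fixed receiver index `y`, of an orthonormal basis of `Q`,
scaled by `√(q^c)`. By `partial_inner_eq` they are orthonormal, and the scaling cancels the
normalization of the maximally entangled state. -/
theorem isEACode_of_receiver {p : ℕ} [Fact p.Prime] {K : Type*} [Field K] [Fintype K]
    [DecidableEq K] [Algebra (ZMod p) K] {n c k : ℕ}
    (Q : Submodule ℂ ((Fin n ⊕ Fin c → K) → ℂ))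
    (hQ : Module.finrank ℂ Q = Fintype.card K ^ k)
    (h : ∀ e : PhaseSpace K (Fin c), e ≠ 0 → ∀ u ∈ Q, ∀ v ∈ Q,
      star u ⬝ᵥ (pauli p (joinPhase K (Fin n) (Fin c) (0, e)) *ᵥ v) = 0) :
    IsEACode k Q := by
  obtain ⟨w, hwQ, hw, hQw⟩ := exists_orthonormal_family (I := Fin k → K) Q (by simp [hQ])
  have hpos : 0 < (Fintype.card K : ℝ) ^ c := pow_pos (Nat.cast_pos.2 Fintype.card_pos) _
  have hr : ((Real.sqrt ((Fintype.card K : ℝ) ^ c) : ℝ) : ℂ) ≠ 0 :=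
    Complex.ofReal_ne_zero.2 (Real.sqrt_pos.2 hpos).ne'
  have hsq : ((Real.sqrt ((Fintype.card K : ℝ) ^ c) : ℝ) : ℂ) *
      ((Real.sqrt ((Fintype.card K : ℝ) ^ c) : ℝ) : ℂ) = (Fintype.card K : ℂ) ^ c := by
    rw [← Complex.ofReal_mul, Real.mul_self_sqrt hpos.le]
    push_cast
    rfl
  refine ⟨Matrix.of fun x sy =>
    (Real.sqrt ((Fintype.card K : ℝ) ^ c) : ℝ) * w sy.1 (Sum.elim x sy.2), ?_, fun v => ?_⟩
  · ext ⟨s, y⟩ ⟨t, z⟩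
    have h1 := partial_inner_eq (p := p) (w s) (w t)
      (fun e he => h e he _ (hwQ s) _ (hwQ t)) y z
    rw [Fintype.card_fin, hw] at h1
    rw [Matrix.mul_apply, Matrix.one_apply]
    simp only [Matrix.conjTranspose_apply, Matrix.of_apply, star_mul', Complex.star_def, Complex.conj_ofReal]
    simp only [Complex.star_def] at h1
    have h2 : (if (s, y) = (t, z) then (1 : ℂ) else 0) =
        if y = z then (if s = t then 1 else 0) else 0 := by
      by_cases hy : y = z <;> simp [hy, Prod.ext_iff]
    rw [h2, ← h1, ← hsq, Finset.mul_sum]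
    exact Finset.sum_congr rfl fun x _ => by ring
  · rw [hQw]
    refine exists_congr fun ψ => ?_
    have h1 : ∀ (x : Fin n → K) (y : Fin c → K),
        ((Real.sqrt ((Fintype.card K : ℝ) ^ c))⁻¹ : ℝ) * ∑ s,
          (Real.sqrt ((Fintype.card K : ℝ) ^ c) : ℝ) * w s (Sum.elim x y) * ψ s =
        (∑ i, ψ i • w i) (Sum.elim x y) := fun x y => by
      rw [Finset.sum_apply, Complex.ofReal_inv, Finset.mul_sum]
      refine Finset.sum_congr rfl fun s _ => ?_
      rw [mul_assoc, inv_mul_cancel_left₀ hr, Pi.smul_apply, smul_eq_mul, mul_comm]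
    simp only [Matrix.of_apply, h1]
    refine ⟨fun hv x y => by rw [hv], fun hv => funext fun a => ?_⟩
    rw [← Sum.elim_comp_inl_inr a]
    exact hv _ _

/-! ### Entanglement-assisted codes from subgroups of the phase space -/

section EAConstruction

variable {p : ℕ} [Fact p.Prime] {K : Type*} [Field K] [Fintype K] [DecidableEq K]
  [Algebra (ZMod p) K] {ι κ : Type*} [Fintype ι] [DecidableEq ι] [Fintype κ] [DecidableEq κ]

theorem natCard_phaseSpace : Nat.card (PhaseSpace K κ) = Fintype.card K ^ (2 * Fintype.card κ) := by
  rw [Nat.card_eq_fintype_card, Fintype.card_prod, Fintype.card_fun, ← pow_add, two_mul]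

/-- A subgroup of the phase space whose symplectic rank is `2 |κ|` maps anti-isometrically onto
the phase space over `κ`. -/
theorem exists_antiisometry (S : AddSubgroup (PhaseSpace K ι)) {l : ℕ}
    (hrad : Nat.card {s : PhaseSpace K ι | s ∈ S ∧ ∀ t ∈ S, symplecticForm p K ι s t = 0} =
      Fintype.card K ^ l)
    (hS : Nat.card S = Fintype.card K ^ (l + 2 * Fintype.card κ)) :
    ∃ f : S →+ PhaseSpace K κ, Function.Surjective f ∧
      ∀ s t : S, symplecticForm p K κ (f s) (f t) = -symplecticForm p K ι s t := by
  let V := AddSubgroup.toZModSubmodule p S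
  let B := -(symplecticForm p K ι).domRestrict₁₂ V V
  have hB : ∀ s t : V, B s t = -symplecticForm p K ι s t := fun s t => rfl
  have hker : Nat.card (LinearMap.ker B) = Fintype.card K ^ l := by
    rw [← hrad]
    refine Nat.card_congr
      { toFun := fun s => ⟨s.1.1, s.1.2, fun t ht => ?_⟩
        invFun := fun s => ⟨⟨s.1, s.2.1⟩, ?_⟩
        left_inv := fun s => rfl
        right_inv := fun s => rfl }
    · have h := LinearMap.congr_fun (LinearMap.mem_ker.1 s.2) ⟨t, ht⟩
      rwa [hB, LinearMap.zero_apply, neg_eq_zero] at h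
    · refine LinearMap.mem_ker.2 (LinearMap.ext fun t => ?_)
      rw [hB, s.2.2 t t.2, neg_zero, LinearMap.zero_apply]
  -- Dimensions are taken over `F_p`, because `S` is only additive; they are read off from the
  -- cardinalities.
  have hd : Module.finrank (ZMod p) V =
      Module.finrank (ZMod p) (LinearMap.ker B) + Module.finrank (ZMod p) (PhaseSpace K κ) := by
    have h1 : Nat.card V = Nat.card (LinearMap.ker B) * Nat.card (PhaseSpace K κ) := by
      rw [hker, natCard_phaseSpace, ← pow_add]
      exact hS
    rw [Module.natCard_eq_pow_finrank (K := ZMod p) (V := V),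
      Module.natCard_eq_pow_finrank (K := ZMod p) (V := LinearMap.ker B),
      Module.natCard_eq_pow_finrank (K := ZMod p) (V := PhaseSpace K κ), ← pow_add,
      Nat.card_zmod] at h1
    exact Nat.pow_right_injective (Fact.out : p.Prime).two_le h1
  obtain ⟨f, hf, hfB⟩ := exists_isometry_surjective B (symplecticForm p K κ)
    (fun s => by rw [hB, (symplecticForm_isAlt p).self_eq_zero, neg_zero])
    (symplecticForm_isAlt p) (symplecticForm_nondegenerate p) hd
  exact ⟨f.toAddMonoidHom, hf, hfB⟩

theorem natCard_tauImage_mul_finrank_codeSpace {S : AddSubgroup (PhaseSpace K ι)}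
    {T : Subgroup (Matrix.unitaryGroup (ι → K) ℂ)} (hT : IsStabilizerGroup p T)
    (hTS : tauImage p T = (S : Set (PhaseSpace K ι))) :
    Nat.card S * Module.finrank ℂ (codeSpace T) = Fintype.card K ^ Fintype.card ι := by
  rw [← hT.finrank_codeSpace, hTS]
  rfl

theorem finrank_codeSpace_of_card {S : AddSubgroup (PhaseSpace K ι)}
    {T : Subgroup (Matrix.unitaryGroup (ι → K) ℂ)} (hT : IsStabilizerGroup p T)
    (hTS : tauImage p T = (S : Set (PhaseSpace K ι))) {r k : ℕ}
    (hr : Nat.card S = Fintype.card K ^ r) (hk : Fintype.card ι = k + r) :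
    Module.finrank ℂ (codeSpace T) = Fintype.card K ^ k := by
  have h := natCard_tauImage_mul_finrank_codeSpace hT hTS
  rw [hr, hk, pow_add, mul_comm] at h
  exact Nat.eq_of_mul_eq_mul_right (pow_pos Fintype.card_pos _) h

/-- An isotropic subgroup of order `q^r` of the phase space of `m` qudits gives an
`[[m, m - r]]_q` stabilizer code. -/
theorem exists_stabilizesParams {m r k : ℕ} (S : AddSubgroup (PhaseSpace K (Fin m)))
    (hS : ∀ s ∈ S, ∀ t ∈ S, symplecticForm p K (Fin m) s t = 0)
    (hr : Nat.card S = Fintype.card K ^ r) (hk : m = k + r) :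
    ∃ T : Subgroup (Matrix.unitaryGroup (Fin m → K) ℂ), StabilizesParams p T k ∧
      tauImage p T = (S : Set (PhaseSpace K (Fin m))) := by
  obtain ⟨T, hT, hTS⟩ := exists_isStabilizerGroup S hS
  exact ⟨T, ⟨hT, finrank_codeSpace_of_card hT hTS hr (by simpa using hk)⟩, hTS⟩

/-- A subgroup of the phase space of `n` qudits, of order `q^(l + 2c)` and with a symplectic
radical of order `q^l`, EA-stabilizes an `[[n, n - c - l, d; c]]_q` code, where `d` is the least
weight of a phase space point that is orthogonal to the subgroup but not contained in it. -/
theorem eaStabilizesParams_of_card {n k l c : ℕ} (S : AddSubgroup (PhaseSpace K (Fin n)))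
    (hrad : Nat.card {s : PhaseSpace K (Fin n) |
      s ∈ S ∧ ∀ t ∈ S, symplecticForm p K (Fin n) s t = 0} = Fintype.card K ^ l)
    (hS : Nat.card S = Fintype.card K ^ (l + 2 * c)) (hn : n = k + c + l) :
    EAStabilizesParams p S k
      (⨅ e ∈ {e : PhaseSpace K (Fin n) |
        (∀ t ∈ S, symplecticForm p K (Fin n) e t = 0) ∧ e ∉ S}, (pauliWeight e : ℕ∞)) c := by
  obtain ⟨f, hf, hfB⟩ := exists_antiisometry (κ := Fin c) S hrad (by simpa using hS)
  let φ : S →+ PhaseSpace K (Fin n ⊕ Fin c) :=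
    (joinPhase K (Fin n) (Fin c)).comp (S.subtype.prod f)
  have hφ : ∀ s, φ s = joinPhase K (Fin n) (Fin c) (s, f s) := fun s => rfl
  have hφi : Function.Injective φ := fun s t h =>
    Subtype.ext (congrArg Prod.fst (joinPhase_injective h))
  have hφ' : ∀ s, senderPart (φ s) = s := fun s => rfl
  have hon : ∀ e : PhaseSpace K (Fin n), onSender c e = joinPhase K (Fin n) (Fin c) (e, 0) :=
    fun e => rfl
  -- On the graph of `f` the sender's and the receiver's contributions cancel.
  have hiso : ∀ s ∈ φ.range, ∀ t ∈ φ.range, symplecticForm p K (Fin n ⊕ Fin c) s t = 0 := by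
    rintro _ ⟨s, rfl⟩ _ ⟨t, rfl⟩
    rw [hφ, hφ, symplecticForm_joinPhase, hfB, add_neg_cancel]
  obtain ⟨T, hT, hTS⟩ := exists_isStabilizerGroup φ.range hiso
  have hmem : ∀ s : S, φ s ∈ tauImage p T := fun s => hTS ▸ ⟨s, rfl⟩
  have hcard : Nat.card φ.range = Fintype.card K ^ (l + 2 * c) := by
    rw [← hS]
    exact (Nat.card_congr (AddMonoidHom.ofInjective hφi).toEquiv).symm
  have hrank : Module.finrank ℂ (codeSpace T) = Fintype.card K ^ k :=
    finrank_codeSpace_of_card hT hTS hcard (by simp; omega)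
  refine ⟨codeSpace T, ⟨T, hT, ?_, rfl⟩, ?_, ?_⟩
  · rw [hTS]
    refine ⟨?_, ?_, fun s hs => ⟨φ ⟨s, hs⟩, ⟨_, rfl⟩, rfl⟩⟩
    · rintro _ ⟨s, rfl⟩
      exact s.2
    · rintro _ ⟨s, rfl⟩ _ ⟨t, rfl⟩ h
      rw [hφ', hφ'] at h
      rw [Subtype.ext h]
  · refine isEACode_of_receiver (p := p) _ hrank fun e he u hu v hv => ?_
    -- Since `f` is onto, some stabilizer element has a receiver part that fails to commute with
    -- `e`.
    obtain ⟨t, ht⟩ : ∃ t, symplecticForm p K (Fin c) e t ≠ 0 := by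
      by_contra! h
      exact he (symplecticForm_nondegenerate p e h)
    obtain ⟨s, rfl⟩ := hf t
    refine dotProduct_pauli_mulVec_eq_zero (hmem s) ?_ hu hv
    rwa [hφ, symplecticForm_joinPhase, map_zero, LinearMap.zero_apply, zero_add]
  · have hform : ∀ (e : PhaseSpace K (Fin n)) (s : S),
        symplecticForm p K (Fin n ⊕ Fin c) (onSender c e) (φ s) =
          symplecticForm p K (Fin n) e s := fun e s => by
      rw [hon, hφ, symplecticForm_joinPhase, map_zero, LinearMap.zero_apply, add_zero]
    have hset : {e : PhaseSpace K (Fin n) | ¬ Detects (codeSpace T) (pauli p (onSender c e))} =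
        {e | (∀ t ∈ S, symplecticForm p K (Fin n) e t = 0) ∧ e ∉ S} := by
      ext e
      constructor
      · intro he
        have h1 : ∀ t ∈ S, symplecticForm p K (Fin n) e t = 0 := fun t ht => by
          by_contra h
          rw [← hform e ⟨t, ht⟩] at h
          exact he (detects_of_symplecticForm_ne_zero (hmem _) h)
        refine ⟨h1, fun heS => he (detects_of_mem_tauImage ?_)⟩
        -- A radical element is sent to a point orthogonal to the whole image of `f`, which is
        -- everything. So its extension acts trivially on the receiver, and `e` itself lies in the
        -- stabilizer.
        have h2 : f ⟨e, heS⟩ = 0 := symplecticForm_nondegenerate p _ fun t => by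
          obtain ⟨s, rfl⟩ := hf t
          rw [hfB, h1 s s.2, neg_zero]
        have h3 : onSender c e = φ ⟨e, heS⟩ := by rw [hφ, h2, hon]
        exact h3 ▸ hmem _
      · rintro ⟨h1, h2⟩
        refine not_detects hT ?_ ?_
        · rw [hTS]
          rintro _ ⟨s, rfl⟩
          rw [hform, h1 s s.2]
        · rw [hTS]
          rintro ⟨s, hs⟩
          refine h2 ?_
          have h3 : ((s : S) : PhaseSpace K (Fin n)) = -e := by
            have := congrArg senderPart hs
            rw [hφ'] at this
            rw [this]
            rfl
          rw [← neg_neg e, ← h3]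
          exact S.neg_mem s.2
    rw [eaDistance, hset]

end EAConstruction

/-! ### Cardinalities of trace dual codes -/

section TraceDual

variable {F K L : Type*} [Field F] [Field K] [Fintype K] [Field L] [Algebra F L]
  {ι : Type*} [Fintype ι]

theorem hermInner_sub_right {p : ℕ} [Fact p.Prime] [CharP K p] [CharP L p] (u v w : ι → L) :
    hermInner K u (v - w) = hermInner K u v - hermInner K u w := by
  obtain ⟨d, _, hd⟩ := FiniteField.card K p
  simp only [hermInner, ← Finset.sum_sub_distrib, Pi.sub_apply, ← mul_sub, hd, sub_pow_char_pow]

/-- The linear functional `u ↦ (u, v)_t`. -/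
noncomputable def traceInnerLeft (F K : Type*) {L : Type*} [Field F] [Field K] [Fintype K] [Field L]
    [Algebra F L] {ι : Type*} [Fintype ι] (γ : L) (v : ι → L) : (ι → L) →ₗ[F] F where
  toFun u := traceInner F K γ u v
  map_add' u w := by
    simp only [traceInner, hermInner, Pi.add_apply, add_mul, Finset.sum_add_distrib, mul_add,
      map_add]
  map_smul' a u := by
    simp only [traceInner, hermInner, Pi.smul_apply, smul_mul_assoc, ← Finset.smul_sum,
      mul_smul_comm, map_smul, RingHom.id_apply]

theorem traceInnerLeft_apply (γ : L) (u v : ι → L) :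
    traceInnerLeft F K γ v u = traceInner F K γ u v := rfl

theorem eq_zero_of_traceInner_eq_zero [Finite L] [Finite F] {γ : L} (hγ : γ ≠ 0) {v : ι → L}
    (h : ∀ u, traceInner F K γ u v = 0) : v = 0 := by
  classical
  funext j
  have h1 : ∀ y : L, Algebra.trace F L (γ * v j ^ Fintype.card K * y) = 0 := fun y => by
    have h2 := h (Pi.single j y)
    rw [traceInner, hermInner, Finset.sum_eq_single j
      (fun i _ hi => by rw [Pi.single_eq_of_ne hi, zero_mul]) (by simp), Pi.single_eq_same] at h2
    rw [← h2]
    ring_nf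
  have h3 := (traceForm_nondegenerate F L).1 _ h1
  exact eq_zero_of_pow_eq_zero ((mul_eq_zero.1 h3).resolve_left hγ)

/-- An additive code and its trace dual have at most `|L^ι|` elements together. -/
theorem natCard_mul_natCard_traceDual_le {p : ℕ} [Fact p.Prime] [CharP K p] [CharP L p] [Finite L]
    [Finite F] {γ : L} (hγ : γ ≠ 0) (C : AddSubgroup (ι → L)) :
    Nat.card C * Nat.card (traceDual F K γ C) ≤ Nat.card (ι → L) := by
  -- The form is `F`-linear in its first argument, so the dual is an `F`-subspace even when `C` is
  -- only additive. Then `C` embeds into the annihilator of `D`, which yields an inequality.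
  let D : Submodule F (ι → L) :=
    { traceDual F K γ C with
      smul_mem' := fun a u hu v hv => by
        rw [← traceInnerLeft_apply, map_smul, traceInnerLeft_apply, hu v hv, smul_zero] }
  have hD : Nat.card D = Nat.card (traceDual F K γ C) := rfl
  let Φ : C → D.dualAnnihilator := fun v =>
    ⟨traceInnerLeft F K γ v, (Submodule.mem_dualAnnihilator _).2 fun u hu => hu v v.2⟩
  have hΦ : Function.Injective Φ := fun v w h => by
    refine Subtype.ext (sub_eq_zero.1 (eq_zero_of_traceInner_eq_zero (F := F) (K := K) hγ
      fun u => ?_))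
    have h1 : traceInner F K γ u v = traceInner F K γ u w :=
      LinearMap.congr_fun (congrArg Subtype.val h) u
    rw [traceInner, hermInner_sub_right (p := p), mul_sub, map_sub]
    exact sub_eq_zero.2 h1
  have : Finite D.dualAnnihilator := Module.finite_of_finite F
  have h1 := Nat.card_le_card_of_injective Φ hΦ
  have h2 := Subspace.finrank_add_finrank_dualAnnihilator_eq D
  rw [← hD]
  calc Nat.card C * Nat.card D ≤ Nat.card D.dualAnnihilator * Nat.card D :=
        Nat.mul_le_mul_right _ h1
    _ = Nat.card (ι → L) := by
        rw [Module.natCard_eq_pow_finrank (K := F) (V := D.dualAnnihilator),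
          Module.natCard_eq_pow_finrank (K := F) (V := D),
          Module.natCard_eq_pow_finrank (K := F) (V := ι → L), ← pow_add, add_comm, h2]

theorem natCard_sup_of_disjoint {G : Type*} [AddCommGroup G] {H H' : AddSubgroup G}
    (h : H ⊓ H' = ⊥) : Nat.card (H ⊔ H' : AddSubgroup G) = Nat.card H * Nat.card H' := by
  rw [← Nat.card_prod]
  refine (Nat.card_congr (Equiv.ofBijective
    (fun x : H × H' => (⟨x.1 + x.2, AddSubgroup.add_mem_sup x.1.2 x.2.2⟩ :
      (H ⊔ H' : AddSubgroup G))) ⟨fun x y hxy => ?_, fun z => ?_⟩)).symm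
  · exact AddSubgroup.add_injective_of_disjoint (disjoint_iff.2 h) (congrArg Subtype.val hxy)
  · obtain ⟨x, hx, y, hy, hxy⟩ := AddSubgroup.mem_sup.1 z.2
    exact ⟨(⟨x, hx⟩, ⟨y, hy⟩), Subtype.ext hxy⟩

end TraceDual

/-! ### Codes and the phase space -/

section PhaseToCode

variable {K L : Type*} [Field K] [Fintype K] [Field L] [Algebra K L] {ι : Type*}

theorem add_pow_card_field (x y : L) :
    (x + y) ^ Fintype.card K = x ^ Fintype.card K + y ^ Fintype.card K :=
  map_add (FiniteField.frobeniusAlgHom K L) x y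

theorem algebraMap_pow_card (x : K) :
    algebraMap K L x ^ Fintype.card K = algebraMap K L x := by
  rw [← map_pow, FiniteField.pow_card]

theorem natCard_of_finrank_two (hL : Module.finrank K L = 2) : Nat.card L = Fintype.card K ^ 2 := by
  have : Module.Finite K L := Module.finite_of_finrank_pos (by omega)
  rw [Module.natCard_eq_pow_finrank (K := K), hL, Nat.card_eq_fintype_card]

theorem pow_card_pow_card (hL : Module.finrank K L = 2) (x : L) :
    (x ^ Fintype.card K) ^ Fintype.card K = x := by
  have : Module.Finite K L := Module.finite_of_finrank_pos (by omega)
  have : Finite L := Module.finite_of_finite K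
  have := Fintype.ofFinite L
  rw [← pow_mul, ← sq, ← natCard_of_finrank_two hL, Nat.card_eq_fintype_card, FiniteField.pow_card]

theorem algebraMap_trace_of_finrank_two (hL : Module.finrank K L = 2) (x : L) :
    algebraMap K L (Algebra.trace K L x) = x + x ^ Fintype.card K := by
  have : Module.Finite K L := Module.finite_of_finrank_pos (by omega)
  have : Finite L := Module.finite_of_finite K
  rw [FiniteField.algebraMap_trace_eq_sum_pow, hL, Nat.card_eq_fintype_card]
  simp [Finset.sum_range_succ]

/-- `phaseToCode` as a group homomorphism. -/
def phaseToCodeHom (K ι : Type*) {L : Type*} [Field K] [Fintype K] [Field L] [Algebra K L] (β : L) :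
    PhaseSpace K ι →+ (ι → L) where
  toFun := phaseToCode β
  map_zero' := by
    funext j
    simp [phaseToCode]
  map_add' s t := by
    funext j
    simp only [phaseToCode, Prod.fst_add, Prod.snd_add, Pi.add_apply, map_add]
    ring

theorem phaseToCodeHom_apply (β : L) (s : PhaseSpace K ι) :
    phaseToCodeHom K ι β s = phaseToCode β s := rfl

theorem phaseToCode_apply_eq_zero_iff {β : L} (hβ : LinearIndependent K ![β, β ^ Fintype.card K])
    (s : PhaseSpace K ι) (j : ι) : phaseToCode β s j = 0 ↔ s.1 j = 0 ∧ s.2 j = 0 := by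
  constructor
  · intro h
    refine LinearIndependent.pair_iff.1 hβ _ _ ?_
    rw [Algebra.smul_def, Algebra.smul_def, mul_comm, mul_comm (algebraMap K L (s.2 j))]
    exact h
  · rintro ⟨h1, h2⟩
    simp [phaseToCode, h1, h2]

theorem hammingNorm_phaseToCode [DecidableEq K] [DecidableEq L] [Fintype ι] {β : L}
    (hβ : LinearIndependent K ![β, β ^ Fintype.card K]) (s : PhaseSpace K ι) :
    hammingNorm (phaseToCode β s) = pauliWeight s := by
  simp only [hammingNorm, pauliWeight, ne_eq, phaseToCode_apply_eq_zero_iff hβ, not_and_or]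

theorem bijective_phaseToCodeHom [Fintype ι] (hL : Module.finrank K L = 2) {β : L}
    (hβ : LinearIndependent K ![β, β ^ Fintype.card K]) :
    Function.Bijective (phaseToCodeHom K ι β) := by
  classical
  have : Module.Finite K L := Module.finite_of_finrank_pos (by omega)
  have : Finite L := Module.finite_of_finite K
  refine (Nat.bijective_iff_injective_and_card _).2 ⟨?_, ?_⟩
  · rw [injective_iff_map_eq_zero]
    intro s hs
    have h := fun j => (phaseToCode_apply_eq_zero_iff hβ s j).1 (congrFun hs j)
    exact Prod.ext (funext fun j => (h j).1) (funext fun j => (h j).2)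
  · rw [natCard_phaseSpace, Nat.card_fun, natCard_of_finrank_two hL, ← pow_mul,
      Nat.card_eq_fintype_card]

variable {F : Type*} [Field F] [Algebra F K] [Algebra F L] [IsScalarTower F K L]

/-- The trace to `K` is `x + x^q`. Since `γ^q = -γ`, the terms with the norm `β^(q+1)` cancel, and
the cross terms combine with coefficient `γ(β² - β^(2q))`. -/
theorem trace_mul_hermInner_phaseToCode [Fintype ι] (hL : Module.finrank K L = 2) {γ β : L}
    (hγ : γ ^ Fintype.card K = -γ) {a : F}
    (ha : γ * (β ^ 2 - β ^ (2 * Fintype.card K)) = algebraMap F L a) (s t : PhaseSpace K ι) :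
    Algebra.trace K L (γ * hermInner K (phaseToCode β s) (phaseToCode β t)) =
      a • (s.1 ⬝ᵥ t.2 - s.2 ⬝ᵥ t.1) := by
  rw [hermInner, Finset.mul_sum, map_sum, dotProduct, dotProduct, ← Finset.sum_sub_distrib,
    Finset.smul_sum]
  refine Finset.sum_congr rfl fun j _ => (algebraMap K L).injective ?_
  have hβ := pow_card_pow_card hL β
  rw [algebraMap_trace_of_finrank_two hL, Algebra.smul_def, map_mul, ← IsScalarTower.algebraMap_apply,
    ← ha, mul_comm 2, pow_mul, map_sub, map_mul, map_mul]
  simp only [phaseToCode, add_pow_card_field, mul_pow, algebraMap_pow_card, hβ, hγ]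
  ring

theorem traceInner_phaseToCode [Fintype ι] (hL : Module.finrank K L = 2) {γ β : L}
    (hγ : γ ^ Fintype.card K = -γ) {a : F}
    (ha : γ * (β ^ 2 - β ^ (2 * Fintype.card K)) = algebraMap F L a) (s t : PhaseSpace K ι) :
    traceInner F K γ (phaseToCode β s) (phaseToCode β t) =
      a * Algebra.trace F K (s.1 ⬝ᵥ t.2 - s.2 ⬝ᵥ t.1) := by
  have : Module.Finite K L := Module.finite_of_finrank_pos (by omega)
  have : Finite F := Finite.of_injective _ (algebraMap F K).injective
  rw [traceInner, ← Algebra.trace_trace (S := K), trace_mul_hermInner_phaseToCode hL hγ ha, map_smul,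
    smul_eq_mul]

/-- `β² - β^(2q) = (β + β^q)(β - β^q)`, and a vanishing factor would be a linear relation between
`β` and `β^q`. -/
theorem ne_zero_of_basis {γ β : L} (hγ : γ ≠ 0)
    (hβ : LinearIndependent K ![β, β ^ Fintype.card K]) {a : F}
    (ha : γ * (β ^ 2 - β ^ (2 * Fintype.card K)) = algebraMap F L a) : a ≠ 0 := by
  rintro rfl
  rw [map_zero, mul_comm 2, pow_mul, sq_sub_sq] at ha
  have h := LinearIndependent.pair_iff.1 hβ
  rcases mul_eq_zero.1 ((mul_eq_zero.1 ha).resolve_left hγ) with h1 | h1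
  · exact one_ne_zero (h 1 1 (by simpa using h1)).1
  · exact one_ne_zero (h 1 (-1) (by simpa [sub_eq_add_neg] using h1)).1

/-- Under `phaseToCode`, the trace dual of an `F`-linear code is the symplectic dual. -/
theorem phaseToCode_mem_traceDual_iff {p : ℕ} [Fact p.Prime] [Algebra (ZMod p) K] [Fintype ι]
    (hL : Module.finrank K L = 2) {γ β : L} (hγ0 : γ ≠ 0) (hγ : γ ^ Fintype.card K = -γ)
    (hβ : LinearIndependent K ![β, β ^ Fintype.card K]) {a : F}
    (ha : γ * (β ^ 2 - β ^ (2 * Fintype.card K)) = algebraMap F L a)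
    {C : AddSubgroup (ι → L)} (hC : ∀ (x : F), ∀ v ∈ C, x • v ∈ C) (e : PhaseSpace K ι) :
    phaseToCode β e ∈ traceDual F K γ C ↔
      ∀ t ∈ C.comap (phaseToCodeHom K ι β), symplecticForm p K ι e t = 0 := by
  classical
  have : CharP K p := charP_of_injective_algebraMap (algebraMap (ZMod p) K).injective p
  have : CharP F p := (RingHom.charP_iff (algebraMap F K) (algebraMap F K).injective p).2 this
  have : Finite F := Finite.of_injective _ (algebraMap F K).injective
  let _ : Algebra (ZMod p) F := ZMod.algebra F p
  have : IsScalarTower (ZMod p) F K := IsScalarTower.of_algebraMap_eq' (RingHom.ext_zmod _ _)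
  have ha0 := ne_zero_of_basis hγ0 hβ ha
  have hs : ∀ t : PhaseSpace K ι, symplecticForm p K ι e t =
      Algebra.trace (ZMod p) F (-Algebra.trace F K (e.1 ⬝ᵥ t.2 - e.2 ⬝ᵥ t.1)) := fun t => by
    rw [symplecticForm_apply, ← map_sub, ← Algebra.trace_trace (S := F), ← map_neg, neg_sub,
      dotProduct_comm t.2]
  constructor
  · intro h t ht
    have h1 := h _ ht
    rw [phaseToCodeHom_apply, traceInner_phaseToCode hL hγ ha] at h1
    rw [hs, (mul_eq_zero.1 h1).resolve_left ha0, neg_zero, map_zero]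
  · intro h v hv
    obtain ⟨t, rfl⟩ := (bijective_phaseToCodeHom hL hβ).2 v
    rw [phaseToCodeHom_apply, traceInner_phaseToCode hL hγ ha]
    -- The symplectic form sees only the trace down to `F_p`. Scaling `t` by every `x ∈ F`, which
    -- `F`-linearity of `C` permits, recovers the `F`-valued trace by nondegeneracy of the trace
    -- form.
    have h1 : ∀ x : F, Algebra.trace (ZMod p) F
        (Algebra.trace F K (e.1 ⬝ᵥ t.2 - e.2 ⬝ᵥ t.1) * x) = 0 := fun x => by
      have hx : phaseToCode β (x • t) = x • phaseToCode β t := by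
        funext j
        simp only [phaseToCode, Prod.smul_fst, Prod.smul_snd, Pi.smul_apply]
        rw [Algebra.smul_def x (t.1 j), Algebra.smul_def x (t.2 j), map_mul, map_mul,
          ← IsScalarTower.algebraMap_apply, Algebra.smul_def x]
        ring
      have h2 := h (x • t) (by
        rw [AddSubgroup.mem_comap, phaseToCodeHom_apply, hx]
        exact hC x _ hv)
      rw [hs, Prod.smul_fst, Prod.smul_snd, dotProduct_smul, dotProduct_smul, ← smul_sub, map_smul,
        map_neg, neg_eq_zero, smul_eq_mul, mul_comm] at h2
      exact h2
    rw [(traceForm_nondegenerate (ZMod p) F).1 _ h1, mul_zero]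

end PhaseToCode

/-! ### Coordinate subgroups of the phase space -/

section Coordinate

variable {p : ℕ} [Fact p.Prime] {K : Type*} [Field K] [Fintype K] [DecidableEq K]
  [Algebra (ZMod p) K] {ι : Type*} [Fintype ι] [DecidableEq ι]

/-- The pairs `(a|b)` with `a` supported on `A` and `b` supported on `B`. -/
def coordinatePhase (K : Type*) [Field K] {ι : Type*} (A B : Finset ι) :
    AddSubgroup (PhaseSpace K ι) where
  carrier := {s | (∀ i ∉ A, s.1 i = 0) ∧ ∀ i ∉ B, s.2 i = 0}
  zero_mem' := ⟨fun _ _ => rfl, fun _ _ => rfl⟩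
  add_mem' := fun hs ht =>
    ⟨fun i hi => by rw [Prod.fst_add, Pi.add_apply, hs.1 i hi, ht.1 i hi, add_zero],
      fun i hi => by rw [Prod.snd_add, Pi.add_apply, hs.2 i hi, ht.2 i hi, add_zero]⟩
  neg_mem' := fun hs =>
    ⟨fun i hi => by rw [Prod.fst_neg, Pi.neg_apply, hs.1 i hi, neg_zero],
      fun i hi => by rw [Prod.snd_neg, Pi.neg_apply, hs.2 i hi, neg_zero]⟩

/-- A point of `coordinatePhase K A B` is given by its coordinates on `A` and on `B`. -/
def coordinatePhaseEquiv (A B : Finset ι) : coordinatePhase K A B ≃ (A → K) × (B → K) where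
  toFun s := (fun i => s.1.1 i, fun i => s.1.2 i)
  invFun f := ⟨(fun i => if h : i ∈ A then f.1 ⟨i, h⟩ else 0,
    fun i => if h : i ∈ B then f.2 ⟨i, h⟩ else 0), fun _ hi => dif_neg hi, fun _ hi => dif_neg hi⟩
  left_inv s := by
    refine Subtype.ext (Prod.ext (funext fun i => ?_) (funext fun i => ?_))
    · by_cases h : i ∈ A
      · simp [h]
      · simp [h, s.2.1 i h]
    · by_cases h : i ∈ B
      · simp [h]
      · simp [h, s.2.2 i h]
  right_inv f := by
    refine Prod.ext (funext fun i => ?_) (funext fun i => ?_) <;> simp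

theorem natCard_coordinatePhase (A B : Finset ι) :
    Nat.card (coordinatePhase K A B) = Fintype.card K ^ (A.card + B.card) := by
  rw [Nat.card_congr (coordinatePhaseEquiv A B), Nat.card_eq_fintype_card, Fintype.card_prod,
    Fintype.card_fun, Fintype.card_fun, Fintype.card_coe, Fintype.card_coe, pow_add]

theorem symplecticForm_coordinatePhase_empty {B B' : Finset ι} {s t : PhaseSpace K ι}
    (hs : s ∈ coordinatePhase K ∅ B) (ht : t ∈ coordinatePhase K ∅ B') :
    symplecticForm p K ι s t = 0 := by
  have h1 : s.1 = 0 := funext fun i => hs.1 i (Finset.notMem_empty i)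
  have h2 : t.1 = 0 := funext fun i => ht.1 i (Finset.notMem_empty i)
  rw [symplecticForm_apply, h1, h2, dotProduct_zero, dotProduct_zero, sub_self]

/-- Coordinates in `A` carry both `X` and `Z`, which pair nondegenerately; those in `B \ A` carry
only `Z`, which commutes with the whole subgroup. -/
theorem coordinatePhase_radical {A B : Finset ι} (hAB : A ⊆ B) :
    {s : PhaseSpace K ι | s ∈ coordinatePhase K A B ∧
      ∀ t ∈ coordinatePhase K A B, symplecticForm p K ι s t = 0} =
        coordinatePhase K ∅ (B \ A) := by
  ext s
  constructor
  · rintro ⟨hs, h⟩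
    refine ⟨fun i _ => ?_, fun i hi => ?_⟩
    · by_cases hiB : i ∈ B
      · by_contra h0
        obtain ⟨y, hy⟩ := exists_trace_mul_ne_zero p h0
        have h1 := h (0, Pi.single i y) ⟨fun _ _ => rfl, fun j hj =>
          Pi.single_eq_of_ne (fun h : j = i => hj (h ▸ hiB)) _⟩
        rw [symplecticForm_apply, dotProduct_zero, map_zero, zero_sub, neg_eq_zero,
          single_dotProduct, mul_comm] at h1
        exact hy h1
      · exact hs.1 i fun hiA => hiB (hAB hiA)
    · by_cases hiA : i ∈ A
      · by_contra h0
        obtain ⟨y, hy⟩ := exists_trace_mul_ne_zero p h0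
        have h1 := h (Pi.single i y, 0) ⟨fun j hj =>
          Pi.single_eq_of_ne (fun h : j = i => hj (h ▸ hiA)) _, fun _ _ => rfl⟩
        rw [symplecticForm_apply, zero_dotProduct, map_zero, sub_zero, dotProduct_single] at h1
        exact hy h1
      · exact hs.2 i fun hiB => hi (Finset.mem_sdiff.2 ⟨hiB, hiA⟩)
  · intro hs
    have h1 : s.1 = 0 := funext fun i => hs.1 i (Finset.notMem_empty i)
    refine ⟨⟨fun i _ => congrFun h1 i, fun i hi => hs.2 i fun h => hi (Finset.mem_sdiff.1 h).1⟩,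
      fun t ht => ?_⟩
    have h2 : s.2 ⬝ᵥ t.1 = 0 := Finset.sum_eq_zero fun i _ => by
      by_cases hiA : i ∈ A
      · rw [hs.2 i fun h => (Finset.mem_sdiff.1 h).2 hiA, zero_mul]
      · rw [ht.1 i hiA, mul_zero]
    rw [symplecticForm_apply, h1, h2, dotProduct_zero, sub_self]

/-- Taking `|A| = c` and `|B| = c + l` gives order `q^(l+2c)` and a radical of order `q^l`. -/
theorem exists_eaStabilizesParams (p : ℕ) [Fact p.Prime] (K : Type*) [Field K] [Fintype K]
    [DecidableEq K] [Algebra (ZMod p) K] {n k l c : ℕ} (hn : n = k + c + l) :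
    ∃ (S : AddSubgroup (PhaseSpace K (Fin n))) (d : ℕ∞), EAStabilizesParams p S k d c := by
  obtain ⟨B, _, hB⟩ := Finset.exists_subset_card_eq (s := (Finset.univ : Finset (Fin n)))
    (n := c + l) (by rw [Finset.card_fin]; omega)
  obtain ⟨A, hAB, hA⟩ := Finset.exists_subset_card_eq (s := B) (n := c) (by omega)
  refine ⟨coordinatePhase K A B, _, eaStabilizesParams_of_card (l := l) _ ?_ ?_ hn⟩
  · rw [coordinatePhase_radical hAB]
    refine (natCard_coordinatePhase _ _).trans ?_
    rw [Finset.card_sdiff_of_subset hAB, hA, hB, Finset.card_empty]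
    congr 1
    omega
  · rw [natCard_coordinatePhase, hA, hB]
    congr 1
    omega

theorem exists_stabilizesParams_of_le (p : ℕ) [Fact p.Prime] (K : Type*) [Field K] [Fintype K]
    [DecidableEq K] [Algebra (ZMod p) K] {m k : ℕ} (hk : k ≤ m) :
    ∃ T : Subgroup (Matrix.unitaryGroup (Fin m → K) ℂ), StabilizesParams p T k := by
  obtain ⟨B, _, hB⟩ := Finset.exists_subset_card_eq (s := (Finset.univ : Finset (Fin m)))
    (n := m - k) (by rw [Finset.card_fin]; omega)
  obtain ⟨T, hT, _⟩ := exists_stabilizesParams (p := p) (r := m - k) (k := k)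
    (coordinatePhase K ∅ B) (fun s hs t ht => symplecticForm_coordinatePhase_empty hs ht)
    (by rw [natCard_coordinatePhase, hB, Finset.card_empty, zero_add]) (by omega)
  exact ⟨T, hT⟩

end Coordinate

/-! ### Combinations from additive codes -/

section Combination

variable {p : ℕ} [Fact p.Prime] {F K L : Type*} [Field F] [Field K] [Fintype K] [DecidableEq K]
  [Field L] [DecidableEq L] [Algebra (ZMod p) K] [Algebra F K] [Algebra K L] [Algebra F L]
  [IsScalarTower F K L]

theorem natCard_comap_of_bijective {G H : Type*} [AddGroup G] [AddGroup H] {f : G →+ H}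
    (hf : Function.Bijective f) (P : Set H) : Nat.card (f ⁻¹' P) = Nat.card P := by
  rw [← Nat.card_image_of_injective hf.1, Set.image_preimage_eq _ hf.2]

/-- The bijection `phaseToCode β` preserves weights and duals. A word of `C^⊥t` lies outside
`R_t(C)` exactly when it lies outside `C`, so the two distances agree. -/
theorem eaStabilizesParams_comap (hL : Module.finrank K L = 2) {γ β : L} (hγ0 : γ ≠ 0)
    (hγ : γ ^ Fintype.card K = -γ) (hβ : LinearIndependent K ![β, β ^ Fintype.card K]) {a : F}
    (ha : γ * (β ^ 2 - β ^ (2 * Fintype.card K)) = algebraMap F L a) {n k l c : ℕ}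
    {C : AddSubgroup (Fin n → L)} (hC : ∀ (x : F), ∀ v ∈ C, x • v ∈ C)
    (hrad : Nat.card (traceRadical F K γ C) = Fintype.card K ^ l)
    (hcard : Nat.card C = Fintype.card K ^ (l + 2 * c)) (hn : n = k + c + l) :
    EAStabilizesParams p (C.comap (phaseToCodeHom K (Fin n) β)) k (codeDistance F K γ C) c := by
  have hbij := bijective_phaseToCodeHom (ι := Fin n) hL hβ
  have hdual := phaseToCode_mem_traceDual_iff (p := p) hL hγ0 hγ hβ ha hC
  have hdist : codeDistance F K γ C = ⨅ e ∈ {e : PhaseSpace K (Fin n) |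
      (∀ t ∈ C.comap (phaseToCodeHom K (Fin n) β), symplecticForm p K (Fin n) e t = 0) ∧
        e ∉ C.comap (phaseToCodeHom K (Fin n) β)}, (pauliWeight e : ℕ∞) := by
    rw [codeDistance, ← hbij.2.iInf_comp]
    refine iInf_congr fun e => ?_
    rw [phaseToCodeHom_apply, hammingNorm_phaseToCode hβ]
    refine iInf_congr_Prop ?_ fun _ => rfl
    rw [Set.mem_ofPred_eq, Set.mem_ofPred_eq, ← hdual, traceRadical, AddSubgroup.mem_inf,
      AddSubgroup.mem_comap, phaseToCodeHom_apply]
    tauto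
  rw [hdist]
  refine eaStabilizesParams_of_card (l := l) _ ?_ ?_ hn
  · rw [← hrad]
    refine Eq.trans (congrArg (fun P : Set (PhaseSpace K (Fin n)) => Nat.card P) ?_)
      (natCard_comap_of_bijective hbij (traceRadical F K γ C))
    ext e
    simp only [Set.mem_ofPred_eq, ← hdual]
    rfl
  · rw [← hcard]
    exact natCard_comap_of_bijective hbij C

theorem exists_stabilizesParams_phaseToCode (hL : Module.finrank K L = 2) {γ β : L} (hγ0 : γ ≠ 0)
    (hγ : γ ^ Fintype.card K = -γ) (hβ : LinearIndependent K ![β, β ^ Fintype.card K]) {a : F}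
    (ha : γ * (β ^ 2 - β ^ (2 * Fintype.card K)) = algebraMap F L a) {m r k : ℕ}
    {C : AddSubgroup (Fin m → L)} (hC : ∀ (x : F), ∀ v ∈ C, x • v ∈ C)
    (hself : IsTraceSelfOrthogonal F K γ C) (hr : Nat.card C = Fintype.card K ^ r)
    (hm : m = k + r) :
    ∃ T : Subgroup (Matrix.unitaryGroup (Fin m → K) ℂ), StabilizesParams p T k ∧
      phaseToCode β '' tauImage p T = (C : Set (Fin m → L)) := by
  have hbij := bijective_phaseToCodeHom (ι := Fin m) hL hβ
  obtain ⟨T, hT, hTC⟩ := exists_stabilizesParams (p := p) (r := r) (k := k)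
    (C.comap (phaseToCodeHom K (Fin m) β))
    (fun s hs => (phaseToCode_mem_traceDual_iff hL hγ0 hγ hβ ha hC s).1 (hself hs))
    ((natCard_comap_of_bijective hbij C).trans hr) hm
  exact ⟨T, hT, by rw [hTC]; exact Set.image_preimage_eq _ hbij.2⟩

end Combination

theorem theorem5 (p : ℕ) [Fact p.Prime]
    {F K L : Type*} [Field F] [Field K] [Fintype K] [DecidableEq K] [Field L] [DecidableEq L]
    [Algebra (ZMod p) K] [Algebra F K] [Algebra K L] [Algebra F L] [IsScalarTower F K L]
    (hL : Module.finrank K L = 2)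
    (γ : L) (hγ : γ = 1 ∨ (γ ≠ 0 ∧ γ ^ Fintype.card K = -γ))
    {n m l c r k_b : ℕ}
    (C Ce : AddSubgroup (Fin n → L))
    (hsup : traceRadical F K γ C ⊔ Ce = C)
    (hinf : traceRadical F K γ C ⊓ Ce = ⊥)
    (hCe : IsACD F K γ Ce)
    (hl : Nat.card (traceRadical F K γ C) = Fintype.card K ^ l)
    (hc : Nat.card Ce = Fintype.card K ^ (2 * c))
    (Cb : AddSubgroup (Fin m → L))
    (hr : Nat.card Cb = Fintype.card K ^ r)
    (hCb : IsTraceSelfOrthogonal F K γ Cb)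
    (hkb : (k_b : ℤ) = m - r) (hck : c ≤ k_b) :
    ∃ k : ℕ, (k : ℤ) = n - c - l ∧
      (∃ (S : AddSubgroup (PhaseSpace K (Fin n)))
        (Sb : Subgroup (Matrix.unitaryGroup (Fin m → K) ℂ)) (d_ea : ℕ∞),
        IsCombination p S Sb k d_ea c k_b) ∧
      (γ ^ Fintype.card K = -γ →
        (∀ (a : F), ∀ v ∈ C, a • v ∈ C) → (∀ (a : F), ∀ v ∈ Cb, a • v ∈ Cb) →
        ∀ β : L, LinearIndependent K ![β, β ^ Fintype.card K] →
          (∃ a : F, γ * (β ^ 2 - β ^ (2 * Fintype.card K)) = algebraMap F L a) →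
          ∃ (S : AddSubgroup (PhaseSpace K (Fin n)))
            (Sb : Subgroup (Matrix.unitaryGroup (Fin m → K) ℂ)),
            phaseToCode β '' (S : Set (PhaseSpace K (Fin n))) = (C : Set (Fin n → L)) ∧
            phaseToCode β '' tauImage p Sb = (Cb : Set (Fin m → L)) ∧
            IsCombination p S Sb k (codeDistance F K γ C) c k_b) := by
  have : Module.Finite K L := Module.finite_of_finrank_pos (by omega)
  have : Finite L := Module.finite_of_finite K
  have : Finite F := Finite.of_injective _ (algebraMap F K).injective
  have : CharP K p := charP_of_injective_algebraMap (algebraMap (ZMod p) K).injective p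
  have : CharP L p := (RingHom.charP_iff (algebraMap K L) (algebraMap K L).injective p).1 this
  have hγ0 : γ ≠ 0 := by
    rcases hγ with rfl | h
    · exact one_ne_zero
    · exact h.1
  have hcard : Nat.card C = Fintype.card K ^ (l + 2 * c) := by
    rw [← hsup, natCard_sup_of_disjoint hinf, hl, hc, ← pow_add]
  -- Comparing exponents in `|C| · |R_t(C)| ≤ |L^n|` gives `(l + 2c) + l ≤ 2n`. It also makes the
  -- truncated subtraction `n - c - l` below exact.
  have hle : c + l ≤ n := by
    have h1 := natCard_mul_natCard_traceDual_le (p := p) (F := F) (K := K) hγ0 C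
    have h2 : Nat.card (traceRadical F K γ C) ≤ Nat.card (traceDual F K γ C) :=
      AddSubgroup.card_le_of_le inf_le_right
    have h3 := (Nat.mul_le_mul_left (Nat.card C) h2).trans h1
    rw [hcard, hl, ← pow_add, Nat.card_fun, natCard_of_finrank_two hL, ← pow_mul,
      Nat.card_eq_fintype_card, Fintype.card_fin,
      Nat.pow_le_pow_iff_right Fintype.one_lt_card] at h3
    omega
  refine ⟨n - c - l, by omega, ?_, fun hγq hCF hCbF β hβ ⟨a, ha⟩ => ?_⟩
  · obtain ⟨S, d, hS⟩ := exists_eaStabilizesParams p K (n := n) (k := n - c - l) (l := l) (c := c)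
      (by omega)
    obtain ⟨Sb, hSb⟩ := exists_stabilizesParams_of_le p K (m := m) (k := k_b) (by omega)
    exact ⟨S, Sb, d, hS, hSb, hck⟩
  · obtain ⟨Sb, hSb, hSbC⟩ := exists_stabilizesParams_phaseToCode (p := p) (k := k_b) hL hγ0 hγq hβ
      ha hCbF hCb hr (by omega)
    exact ⟨C.comap (phaseToCodeHom K (Fin n) β), Sb,
      Set.image_preimage_eq _ (bijective_phaseToCodeHom hL hβ).2, hSbC,
      eaStabilizesParams_comap hL hγ0 hγq hβ ha hCF hl hcard (by omega), hSb, hck⟩
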